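/- Let $\omega = e^{i\pi/3}$ and $\mathbb{T}_6=\{\omega^k : 0\le k\le 5\}$. A signed digraph $\Phi=(G,\varphi)$ consists of a finite simple graph $G$ and a gain $\varphi(uv)\in\mathbb{T}_6$ for every ordered pair $uv$ of adjacent vertices, with $\varphi(vu)=\varphi(uv)^{-1}$. Its Eisenstein matrix $\mathcal{E}(\Phi)$ is the Hermitian matrix with entries $\mathcal{E}_{uv}=\varphi(uv)$ if $u,v$ are adjacent and $0$ otherwise, and its spectrum is the multiset of eigenvalues of $\mathcal{E}(\Phi)$. Two signed digraphs are switching isomorphic if one is obtained from the other by conjugating the Eisenstein matrix with diagonal matrices with diagonal entries in $\mathbb{T}_6$ and by relabelling vertices, possibly followed by taking the converse (transposing the Eisenstein matrix). Let $K_m$ also denote the complete graph on $m$ vertices with all gains $1$, and let $K_m^*$ be obtained from it by orienting exactly one edge, i.e. by giving one edge the gain $\omega$ in one direction and $\omega^{-1}$ in the other (for $m=1$ only $K_1$ is meant). For $n\ge 3$, an $(n-2,2)$-kite is a graph obtained from the disjoint union of a complete graph $K_{n-2}$ and a path $P_2$ by joining one vertex of the complete graph to one end vertex of the path. **Theorem.**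 Let $n\ge 3$, let $G$ be an $(n-2,2)$-kite, and let $\Phi=(G,\varphi)$ be a signed digraph on $G$ such that the signed digraph induced on the $(n-2)$-clique of the kite is switching isomorphic to $K_{n-2}$ or to $K_{n-2}^*$. Then $\Phi$ is determined by its Eisenstein spectrum: every signed digraph with the same spectrum as $\Phi$ is switching isomorphic to $\Phi$. -/

import Mathlib

universe uV uW

/-- A signed digraph on `V`, that is, a gain graph with gains in the group `rootsOfUnity 6 ℂ` of
sixth roots of unity: a simple graph (its symmetric pairs of arcs are the darts) with a gain on
every dart, such that reversing the dart inverts the gain. -/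
structure SignedDigraph (V : Type*) where
  /-- the underlying graph -/
  graph : SimpleGraph V
  /-- the signature -/
  gain : graph.Dart → rootsOfUnity 6 ℂ
  gain_symm : ∀ d : graph.Dart, gain d.symm = (gain d)⁻¹

namespace SignedDigraph

open Classical in
/-- The (unit) Eisenstein matrix: the gain of `uv` if `u` and `v` are adjacent, else `0`. -/
noncomputable def eisenstein {V : Type*} (Φ : SignedDigraph V) : Matrix V V ℂ :=
  Matrix.of fun u v =>
    if h : Φ.graph.Adj u v then (((Φ.gain ⟨(u, v), h⟩ : rootsOfUnity 6 ℂ) : ℂˣ) : ℂ) else 0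

/-- The spectrum: the eigenvalues, i.e. the roots of the characteristic polynomial
`det (λ I - ℰ)`, with multiplicities. -/
noncomputable def spectrum {V : Type*} [Fintype V] [DecidableEq V] (Φ : SignedDigraph V) :
    Multiset ℂ :=
  Φ.eisenstein.charpoly.roots

/-- Two signed digraphs are cospectral if their spectra coincide. -/
def Cospectral {V W : Type*} [Fintype V] [DecidableEq V] [Fintype W] [DecidableEq W]
    (Φ : SignedDigraph V) (Ψ : SignedDigraph W) : Prop :=
  Φ.spectrum = Ψ.spectrum

/-- The subdigraph induced by a set `U` of vertices. -/
def induce {V : Type*} (Φ : SignedDigraph V) (U : Set V) : SignedDigraph U where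
  graph := Φ.graph.induce U
  gain d := Φ.gain ⟨(d.fst.1, d.snd.1), d.adj⟩
  gain_symm d := Φ.gain_symm ⟨(d.fst.1, d.snd.1), d.adj⟩

/-- The converse: every arc is reversed and keeps its sign. The gain of `uv` becomes the
former gain of `vu`, so the Eisenstein matrix is transposed. -/
def converse {V : Type*} (Φ : SignedDigraph V) : SignedDigraph V where
  graph := Φ.graph
  gain d := Φ.gain d.symm
  gain_symm d := Φ.gain_symm d.symm

/-- `Ψ` is obtained from `Φ` by a gain switching and a relabelling of the vertices: up to the
bijection `e`, one has `ℰ(Ψ) = X ℰ(Φ) X⁻¹` for the diagonal matrix `X` with entries `x u`. -/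
def SwitchingRelabelling {V W : Type*} (Φ : SignedDigraph V) (Ψ : SignedDigraph W) : Prop :=
  ∃ (e : V ≃ W) (x : V → rootsOfUnity 6 ℂ), ∀ u v : V,
    Ψ.eisenstein (e u) (e v) =
      ((x u : ℂˣ) : ℂ) * Φ.eisenstein u v * ((x v : ℂˣ) : ℂ)⁻¹

/-- Switching isomorphism: diagonal switches and vertex permutations, possibly followed by
taking the converse. A sequence of switches and permutations is the same as one switch and one
permutation. -/
def SwitchingIsomorphic {V W : Type*} (Φ : SignedDigraph V) (Ψ : SignedDigraph W) : Prop :=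
  SwitchingRelabelling Φ Ψ ∨ SwitchingRelabelling Φ Ψ.converse

/-- `Φ` is determined by its Eisenstein spectrum (DES): it is switching isomorphic to every
signed digraph that is cospectral to it. -/
def IsDES {V : Type uV} [Fintype V] [DecidableEq V] (Φ : SignedDigraph V) : Prop :=
  ∀ (W : Type uW) [Fintype W] [DecidableEq W] (Ψ : SignedDigraph W),
    Cospectral Φ Ψ → SwitchingIsomorphic Φ Ψ

/-- The complete graph `K_n` as a signed digraph, all gains being `1`. -/
def complete (n : ℕ) : SignedDigraph (Fin n) where
  graph := ⊤
  gain _ := 1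
  gain_symm _ := inv_one.symm

/-- The unit `ω = exp (π i / 3) = (1 + i √3) / 2`. -/
noncomputable def omega : rootsOfUnity 6 ℂ :=
  ⟨Units.mk0 (Complex.exp (Real.pi * Complex.I / 3)) (Complex.exp_ne_zero _), by
    rw [mem_rootsOfUnity]
    ext
    rw [Units.val_pow_eq_pow_val, Units.val_mk0, ← Complex.exp_nat_mul, Units.val_one,
      ← Complex.exp_two_pi_mul_I]
    congr 1
    push_cast
    ring⟩

/-- The signed digraph `K_n^*`: the complete graph with exactly one edge oriented. The oriented
edge is the arc from vertex `0` to vertex `1`, whose gain is `ω`. (For `n ≤ 1` there is no edge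
to orient, and this is just `K_n`.) -/
noncomputable def orientedComplete (n : ℕ) : SignedDigraph (Fin n) where
  graph := ⊤
  gain d :=
    if d.fst.val = 0 ∧ d.snd.val = 1 then omega
    else if d.fst.val = 1 ∧ d.snd.val = 0 then omega⁻¹
    else 1
  gain_symm d := by
    rcases d with ⟨⟨u, v⟩, h⟩
    change (if v.val = 0 ∧ u.val = 1 then omega else if v.val = 1 ∧ u.val = 0 then omega⁻¹ else 1) =
      (if u.val = 0 ∧ v.val = 1 then omega else if u.val = 1 ∧ v.val = 0 then omega⁻¹ else 1)⁻¹
    by_cases h1 : u.val = 0 ∧ v.val = 1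
    · simp [h1.1, h1.2]
    · by_cases h2 : u.val = 1 ∧ v.val = 0
      · simp [h2.1, h2.2]
      · rw [if_neg h1, if_neg h2, if_neg (fun h => h2 ⟨h.2, h.1⟩), if_neg (fun h => h1 ⟨h.2, h.1⟩),
          inv_one]

end SignedDigraph

/-- The `(a, b)`-kite (for `a, b ≥ 1`): the disjoint union of the complete graph `K_a` and the
path `P_b`, together with an edge between a vertex of `K_a` and an end vertex of `P_b`. -/
def kiteGraph (a b : ℕ) : SimpleGraph (Fin a ⊕ Fin b) :=
  ((⊤ : SimpleGraph (Fin a)) ⊕g SimpleGraph.pathGraph b) ⊔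
    SimpleGraph.fromRel fun x y =>
      ∃ (i : Fin a) (j : Fin b), i.val = 0 ∧ j.val = 0 ∧ x = Sum.inl i ∧ y = Sum.inr j

/-! Write m = n - 2 and let Ψ be cospectral with the kite Φ. Cospectral Hermitian matrices are
unitarily equivalent, so traces of powers agree and the two Hermitian forms can be compared on
subspaces.

The graph of Ψ. The form of Φ is negative definite on a subspace of codimension 2
(`kiteMatrix_form_neg`), while three pairwise nonadjacent vertices of Ψ span a 3-dimensional space
on which the form of Ψ vanishes. Hence the complement H of the graph of Ψ is triangle-free
(`IsKiteForm.no_three_independent`). The trace of the square shows that H has 2m - 1 edges. The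
trace of the cube is at most that of the underlying adjacency matrix, which for m ≥ 2 forces ∑ d(u)²
≥ 2m² + m (`sum_degree_sq_ge`). This is too large if d(u) + d(v) ≤ m + 1 along every edge, so some
edge uv has neighbourhoods N(u), N(v) partitioning the vertices, and H is bipartite with these
parts. A finer estimate of the degree squares leaves the complements of kites and two exceptions, at
m = 2 and m = 4 (`isKite_or_exceptional`); these are excluded by traces of third and fourth powers.

The gains. Gains on the pendant path can be switched away, and all triangles lie in the clique, so
the trace of the cube is an invariant of the clique. For K_m it is maximal and every triangle is
balanced. For K_m^* the deficit allows at most m - 2 unbalanced triangles; since a tetrahedron never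
has exactly one unbalanced face, they all share an edge (`exists_pair_subset_of_tetrahedra`), and
switching leaves one edge of gain exp(±πi/3) (`IsCliqueGain.oriented_of_trace`).

It remains to locate that edge relative to the attachment vertex. If they meet, at most one
eigenvalue lies below -1; if they do not, at least two do (`not_unitarilyEquiv_kiteMatrix`). With
three clique vertices the edge can always be moved to the attachment vertex. The two possible gains
are exchanged by the converse. -/

open Matrix

namespace SignedDigraph

/-! ### Unitary equivalence and comparison of Hermitian forms. -/

/-- Two square matrices, possibly over different index types, are unitarily equivalent. -/
def UnitarilyEquiv {V W : Type*} [Fintype V] [DecidableEq V] [Fintype W] [DecidableEq W]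
    (A : Matrix V V ℂ) (B : Matrix W W ℂ) : Prop :=
  ∃ Q : Matrix W V ℂ, Qᴴ * Q = 1 ∧ Q * Qᴴ = 1 ∧ B = Q * A * Qᴴ

namespace UnitarilyEquiv

variable {U V W : Type*} [Fintype U] [DecidableEq U] [Fintype V] [DecidableEq V]
  [Fintype W] [DecidableEq W]

lemma symm {A : Matrix V V ℂ} {B : Matrix W W ℂ} (h : UnitarilyEquiv A B) :
    UnitarilyEquiv B A := by
  obtain ⟨Q, h1, h2, rfl⟩ := h
  refine ⟨Qᴴ, by simpa using h2, by simpa using h1, ?_⟩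
  calc A = (Qᴴ * Q) * A * (Qᴴ * Q) := by simp [h1]
    _ = _ := by simp [Matrix.mul_assoc]

lemma trans {A : Matrix U U ℂ} {B : Matrix V V ℂ} {C : Matrix W W ℂ}
    (h : UnitarilyEquiv A B) (h' : UnitarilyEquiv B C) : UnitarilyEquiv A C := by
  obtain ⟨Q, h1, h2, rfl⟩ := h
  obtain ⟨R, h3, h4, rfl⟩ := h'
  refine ⟨R * Q, ?_, ?_, ?_⟩
  · calc (R * Q)ᴴ * (R * Q) = Qᴴ * (Rᴴ * R) * Q := by
          simp [Matrix.conjTranspose_mul, Matrix.mul_assoc]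
      _ = 1 := by simp [h3, h1]
  · calc (R * Q) * (R * Q)ᴴ = R * (Q * Qᴴ) * Rᴴ := by
          simp [Matrix.conjTranspose_mul, Matrix.mul_assoc]
      _ = 1 := by simp [h2, h4]
  · simp [Matrix.conjTranspose_mul, Matrix.mul_assoc]

lemma pow {A : Matrix V V ℂ} {B : Matrix W W ℂ} (h : UnitarilyEquiv A B) (k : ℕ) :
    UnitarilyEquiv (A ^ k) (B ^ k) := by
  obtain ⟨Q, h1, h2, rfl⟩ := h
  refine ⟨Q, h1, h2, ?_⟩
  induction k with
  | zero => simp [h2]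
  | succ k ih =>
    rw [pow_succ, ih, pow_succ]
    calc Q * A ^ k * Qᴴ * (Q * A * Qᴴ) = Q * A ^ k * (Qᴴ * Q) * A * Qᴴ := by
          simp only [Matrix.mul_assoc]
      _ = _ := by simp [h1, Matrix.mul_assoc]

lemma trace_eq {A : Matrix V V ℂ} {B : Matrix W W ℂ} (h : UnitarilyEquiv A B) :
    A.trace = B.trace := by
  obtain ⟨Q, h1, -, rfl⟩ := h
  rw [Matrix.trace_mul_comm, ← Matrix.mul_assoc, h1, Matrix.one_mul]

/-- Interlacing by dimension count: `k` linear conditions on `Qᴴ *ᵥ w c` have a nonzero solution `c`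
in `k + 1` dimensions. It is used to play definiteness of one form against the behaviour of the
other. -/
lemma exists_ne_zero {A : Matrix V V ℂ} {B : Matrix W W ℂ} (h : UnitarilyEquiv A B) {k : ℕ}
    (l : (V → ℂ) →ₗ[ℂ] (Fin k → ℂ)) (w : (Fin (k + 1) → ℂ) →ₗ[ℂ] (W → ℂ)) :
    ∃ c ≠ 0, ∃ y, l y = 0 ∧ star y ⬝ᵥ (A *ᵥ y) = star (w c) ⬝ᵥ (B *ᵥ (w c)) ∧
      star y ⬝ᵥ y = star (w c) ⬝ᵥ w c := by
  obtain ⟨Q, h1, h2, rfl⟩ := h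
  have hk : LinearMap.ker (l ∘ₗ Qᴴ.mulVecLin ∘ₗ w) ≠ ⊥ :=
    LinearMap.ker_ne_bot_of_finrank_lt (by simp)
  obtain ⟨c, hc, hc0⟩ := Submodule.exists_mem_ne_zero_of_ne_bot hk
  refine ⟨c, hc0, Qᴴ *ᵥ w c, hc, ?_, ?_⟩
  · simp only [Matrix.star_mulVec, Matrix.conjTranspose_conjTranspose, Matrix.mulVec_mulVec,
      Matrix.dotProduct_mulVec, Matrix.vecMul_vecMul]
    simp [Matrix.mul_assoc]
  · simp only [Matrix.star_mulVec, Matrix.conjTranspose_conjTranspose, Matrix.dotProduct_mulVec,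
      Matrix.vecMul_vecMul, h2, Matrix.vecMul_one]

lemma of_diagonal {A B : Matrix V V ℂ} (x : V → ℂ) (hx : ∀ v, star (x v) * x v = 1)
    (h : ∀ u v, B u v = x u * A u v * star (x v)) : UnitarilyEquiv A B := by
  refine ⟨Matrix.diagonal x, ?_, ?_, ?_⟩
  · rw [Matrix.diagonal_conjTranspose, Matrix.diagonal_mul_diagonal, ← Matrix.diagonal_one]
    congr 1; ext v; exact hx v
  · rw [Matrix.diagonal_conjTranspose, Matrix.diagonal_mul_diagonal, ← Matrix.diagonal_one]
    congr 1; ext v; rw [mul_comm]; exact hx v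
  · ext u v
    rw [Matrix.diagonal_conjTranspose, Matrix.mul_diagonal, Matrix.diagonal_mul, h]
    rfl

lemma of_charpoly_eq {A B : Matrix V V ℂ} (hA : A.IsHermitian) (hB : B.IsHermitian)
    (h : A.charpoly = B.charpoly) : UnitarilyEquiv A B := by
  have key : ∀ {C : Matrix V V ℂ} (hC : C.IsHermitian),
      UnitarilyEquiv (Matrix.diagonal (RCLike.ofReal ∘ hC.eigenvalues)) C := by
    intro C hC
    refine ⟨hC.eigenvectorUnitary, ?_, ?_, ?_⟩
    · rw [← Matrix.star_eq_conjTranspose]; exact Unitary.coe_star_mul_self _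
    · rw [← Matrix.star_eq_conjTranspose]; exact Unitary.coe_mul_star_self _
    · conv_lhs => rw [hC.spectral_theorem, Unitary.conjStarAlgAut_apply]
      rfl
  have hA' := key hA
  rw [(hA.eigenvalues_eq_eigenvalues_iff hB).2 h] at hA'
  exact hA'.symm.trans (key hB)

/-- Characteristic polynomials of Hermitian matrices split, so the root multiset determines both the
size and the polynomial. A permutation matrix then bridges the two index types. -/
lemma of_roots_eq {A : Matrix V V ℂ} {B : Matrix W W ℂ} (hA : A.IsHermitian)
    (hB : B.IsHermitian) (h : A.charpoly.roots = B.charpoly.roots) : UnitarilyEquiv A B := by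
  have hcard : Fintype.card V = Fintype.card W := by
    have := congrArg Multiset.card h
    rwa [hA.roots_charpoly_eq_eigenvalues, hB.roots_charpoly_eq_eigenvalues, Multiset.card_map,
      Multiset.card_map] at this
  let e := Fintype.equivOfCardEq hcard
  have hc : A.charpoly = B.charpoly := by
    rw [hA.splits_charpoly.eq_prod_roots_of_monic A.charpoly_monic,
      hB.splits_charpoly.eq_prod_roots_of_monic B.charpoly_monic, h]
  have h1 : UnitarilyEquiv A (Matrix.reindex e.symm e.symm B) := by
    refine of_charpoly_eq hA ?_ ?_
    · exact hB.submatrix _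
    · rw [Matrix.charpoly_reindex, hc]
  refine h1.trans ⟨(1 : Matrix V V ℂ).submatrix e.symm id, ?_, ?_, ?_⟩
  · ext i j
    simp [Matrix.mul_apply, Matrix.one_apply, Equiv.symm_apply_eq]
  · ext i j
    simp [Matrix.mul_apply, Matrix.one_apply]
  · ext i j
    simp [Matrix.mul_apply, Matrix.one_apply]

end UnitarilyEquiv

/-! ### Sixth roots of unity and the Hermitian form of a kite. -/

lemma sixth_root_of_add_inv {g : ℂ} (hg : g + g⁻¹ = 1) : g ^ 6 = 1 := by
  have h0 : g ≠ 0 := by rintro rfl; simp at hg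
  have h2 : g ^ 2 = g - 1 := by field_simp at hg; linear_combination hg
  linear_combination (g ^ 4 + g ^ 3 - g - 1) * h2

lemma star_eq_inv_of_pow_six {g : ℂ} (hg : g ^ 6 = 1) : star g = g⁻¹ := by
  have h1 : ‖g‖ = 1 := Complex.norm_eq_one_of_pow_eq_one hg (by norm_num)
  rw [Complex.inv_eq_conj h1]
  rfl

variable {V : Type*} [Fintype V] [DecidableEq V]

/-- The indicator function of the complement of `{p, q}`. -/
def cliqueInd (p q u : V) : ℂ := if u = p ∨ u = q then 0 else 1

/-- The Eisenstein matrix of a kite with clique `V ∖ {p, q}`, attachment vertex `z`, pendant path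
`z, q, p`, and all gains `1` except for the gain `g` of the arc `ab`. -/
noncomputable def kiteMatrix (p q z a b : V) (g : ℂ) : Matrix V V ℂ := fun u v =>
  cliqueInd p q u * cliqueInd p q v - (if u = v then cliqueInd p q u else 0)
    + (g - 1) * ((if u = a then 1 else 0) * (if v = b then 1 else 0))
    + (g⁻¹ - 1) * ((if u = b then 1 else 0) * (if v = a then 1 else 0))
    + (if u = q then 1 else 0) * (if v = z then 1 else 0)
    + (if u = z then 1 else 0) * (if v = q then 1 else 0)
    + (if u = p then 1 else 0) * (if v = q then 1 else 0)
    + (if u = q then 1 else 0) * (if v = p then 1 else 0)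

/-- The sum of the entries of a vector over the clique `V ∖ {p, q}`. -/
noncomputable def cliqueSum (p q : V) : (V → ℂ) →ₗ[ℂ] ℂ :=
  ∑ u, cliqueInd p q u • LinearMap.proj u

lemma cliqueSum_apply (p q : V) (y : V → ℂ) :
    cliqueSum p q y = ∑ u, cliqueInd p q u * y u := by
  simp [cliqueSum]

lemma kiteMatrix_mulVec (p q z a b : V) (g : ℂ) (y : V → ℂ) (u : V) :
    (kiteMatrix p q z a b g *ᵥ y) u =
      cliqueInd p q u * cliqueSum p q y - cliqueInd p q u * y u
      + (if u = a then (g - 1) * y b else 0) + (if u = b then (g⁻¹ - 1) * y a else 0)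
      + (if u = q then y z else 0) + (if u = z then y q else 0)
      + (if u = p then y q else 0) + (if u = q then y p else 0) := by
  simp only [Matrix.mulVec, dotProduct, kiteMatrix, cliqueSum_apply, add_mul, sub_mul,
    Finset.sum_add_distrib, Finset.sum_sub_distrib, mul_assoc, ← Finset.mul_sum, ite_mul,
    one_mul, zero_mul, Finset.sum_ite_eq, Finset.sum_ite_eq', Finset.mem_univ, if_true, mul_ite,
    mul_one, mul_zero]

lemma kiteMatrix_form (p q z a b : V) (g : ℂ) (y : V → ℂ) :
    star y ⬝ᵥ (kiteMatrix p q z a b g *ᵥ y) =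
      star (cliqueSum p q y) * cliqueSum p q y - ∑ u, cliqueInd p q u * (star (y u) * y u)
      + star (y a) * ((g - 1) * y b) + star (y b) * ((g⁻¹ - 1) * y a)
      + star (y q) * y z + star (y z) * y q + star (y p) * y q + star (y q) * y p := by
  have hs : star (cliqueSum p q y) = ∑ u, star (y u) * cliqueInd p q u := by
    rw [cliqueSum_apply, star_sum]
    refine Finset.sum_congr rfl fun u _ => ?_
    rw [star_mul']
    unfold cliqueInd
    split_ifs <;> simp
  simp only [dotProduct, kiteMatrix_mulVec, mul_add, mul_sub, Finset.sum_add_distrib,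
    Finset.sum_sub_distrib, Pi.star_apply, mul_ite, mul_zero, Finset.sum_ite_eq',
    Finset.mem_univ, if_true, hs, Finset.sum_mul, mul_assoc]
  simp only [mul_left_comm]

lemma kiteMatrix_form_re (p q z a b : V) {g : ℂ} (hg : star g = g⁻¹) (y : V → ℂ) :
    (star y ⬝ᵥ (kiteMatrix p q z a b g *ᵥ y)).re =
      Complex.normSq (cliqueSum p q y)
      - ∑ u, (cliqueInd p q u).re * Complex.normSq (y u)
      + 2 * (star (y a) * ((g - 1) * y b)).re + 2 * (star (y q) * (y z + y p)).re := by
  have h1 : ∀ u, (cliqueInd p q u * (star (y u) * y u)).re =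
      (cliqueInd p q u).re * Complex.normSq (y u) := by
    intro u
    have : star (y u) * y u = (Complex.normSq (y u) : ℂ) := Complex.normSq_eq_conj_mul_self.symm
    rw [this, Complex.re_mul_ofReal]
  have h2 : (star (y b) * ((g⁻¹ - 1) * y a)).re = (star (y a) * ((g - 1) * y b)).re := by
    rw [← hg, ← Complex.conj_re]
    congr 1
    change star _ = _
    simp only [star_mul', star_sub, star_star, star_one]
    ring
  rw [kiteMatrix_form]
  simp only [Complex.add_re, Complex.sub_re, h2, Complex.re_sum, h1]
  have h3 : star (cliqueSum p q y) * cliqueSum p q y = (Complex.normSq (cliqueSum p q y) : ℂ) :=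
    Complex.normSq_eq_conj_mul_self.symm
  rw [h3, Complex.ofReal_re]
  simp only [Complex.mul_re, Complex.add_re, Complex.add_im, RCLike.star_def, Complex.conj_re,
    Complex.conj_im]
  ring

lemma star_dotProduct_self_re {p q : V} (hpq : p ≠ q) (y : V → ℂ) :
    (star y ⬝ᵥ y).re = ∑ u, (cliqueInd p q u).re * Complex.normSq (y u)
      + Complex.normSq (y p) + Complex.normSq (y q) := by
  have h1 : ∀ u, (star (y u) * y u).re = (cliqueInd p q u).re * Complex.normSq (y u)
      + (if u = p then Complex.normSq (y u) else 0)
      + (if u = q then Complex.normSq (y u) else 0) := by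
    intro u
    have : star (y u) * y u = (Complex.normSq (y u) : ℂ) := Complex.normSq_eq_conj_mul_self.symm
    rw [this, Complex.ofReal_re]
    unfold cliqueInd
    by_cases h : u = p
    · subst h; simp [hpq]
    · by_cases h' : u = q
      · subst h'; simp [hpq.symm]
      · simp [h, h']
  simp only [dotProduct, Complex.re_sum, Pi.star_apply, h1, Finset.sum_add_distrib,
    Finset.sum_ite_eq', Finset.mem_univ, if_true]

/-- The gain of the distinguished edge of a kite matrix: either there is no distinguished edge, or
it is a primitive sixth root of unity. -/
def EdgeGain (a b : V) (g : ℂ) : Prop := g = 1 ∨ (a ≠ b ∧ g + g⁻¹ = 1)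

omit [Fintype V] [DecidableEq V] in
lemma EdgeGain.star_eq {a b : V} {g : ℂ} (h : EdgeGain a b g) : star g = g⁻¹ := by
  rcases h with rfl | ⟨-, h⟩
  · simp
  · exact star_eq_inv_of_pow_six (sixth_root_of_add_inv h)

/-- On these two hyperplanes the form is minus a sum of squares: `-2|y q|²` from the path, and minus
the clique norm, in which the distinguished edge replaces `|y a|² + |y b|²` by `|y a - (g - 1) y
b|²`. The two linear conditions make the vanishing of all the squares force `y = 0`. -/
lemma kiteMatrix_form_neg {p q z a b : V} {g : ℂ} (hzp : z ≠ p) (hzq : z ≠ q)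
    (hap : a ≠ p) (haq : a ≠ q) (hbp : b ≠ p) (hbq : b ≠ q) (hg : EdgeGain a b g)
    {y : V → ℂ} (hy : y ≠ 0) (hl : y p + y q + y z = 0) (hS : cliqueSum p q y = 0) :
    (star y ⬝ᵥ (kiteMatrix p q z a b g *ᵥ y)).re < 0 := by
  rw [kiteMatrix_form_re _ _ _ _ _ hg.star_eq, hS]
  have hq2 : (star (y q) * (y z + y p)).re = - Complex.normSq (y q) := by
    have : y z + y p = - y q := by linear_combination hl
    rw [this]
    simp [Complex.normSq_apply]
  have hind : ∀ u, 0 ≤ (cliqueInd p q u).re * Complex.normSq (y u) := by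
    intro u
    unfold cliqueInd
    split_ifs <;> simp [Complex.normSq_nonneg]
  have hq0 := Complex.normSq_nonneg (y q)
  have hfin : (∀ u, u ≠ p → u ≠ q → y u = 0) → y q = 0 → False := by
    intro h1 h2
    apply hy
    have h3 : y p = 0 := by
      have := h1 z hzp hzq
      simpa [this, h2] using hl
    funext u
    by_cases hu : u = p
    · rw [hu, h3]; rfl
    · by_cases hu' : u = q
      · rw [hu', h2]; rfl
      · exact h1 u hu hu'
  rw [hq2]
  simp only [map_zero]
  by_contra hcon
  push Not at hcon
  rcases hg with rfl | ⟨hab, hg⟩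
  · simp only [sub_self, zero_mul, mul_zero, Complex.zero_re] at hcon
    have hsum : ∑ u, (cliqueInd p q u).re * Complex.normSq (y u) = 0 :=
      le_antisymm (by linarith) (Finset.sum_nonneg fun u _ => hind u)
    have h1 := (Finset.sum_eq_zero_iff_of_nonneg fun u _ => hind u).1 hsum
    refine hfin (fun u hu hu' => ?_) (Complex.normSq_eq_zero.1 (by linarith))
    have := h1 u (Finset.mem_univ _)
    simpa [cliqueInd, hu, hu'] using this
  · have hg6 := star_eq_inv_of_pow_six (sixth_root_of_add_inv hg)
    have hg0 : g ≠ 0 := by rintro rfl; simp at hg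
    have hn : Complex.normSq (g - 1) = 1 := by
      have h1 : (Complex.normSq (g - 1) : ℂ) = star (g - 1) * (g - 1) :=
        Complex.normSq_eq_conj_mul_self
      have h2 : star (g - 1) * (g - 1) = 1 := by
        rw [star_sub, star_one, hg6]
        field_simp at hg ⊢
        linear_combination -hg
      exact_mod_cast h1.trans h2
    -- Polarization; the coefficients are 1 because `|g - 1| = 1` for a primitive sixth root of
    -- unity.
    have hsq : 2 * (star (y a) * ((g - 1) * y b)).re =
        Complex.normSq (y a) + Complex.normSq (y b) - Complex.normSq (y a - (g - 1) * y b) := by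
      rw [Complex.normSq_sub, map_mul, hn]
      have : (y a * (starRingEnd ℂ) ((g - 1) * y b)).re = (star (y a) * ((g - 1) * y b)).re := by
        rw [← Complex.conj_re]
        simp
      rw [this]; ring
    have hsplit : ∑ u, (cliqueInd p q u).re * Complex.normSq (y u) =
        Complex.normSq (y a) + Complex.normSq (y b) +
        ∑ u ∈ (Finset.univ.erase a).erase b, (cliqueInd p q u).re * Complex.normSq (y u) := by
      rw [← Finset.add_sum_erase _ _ (Finset.mem_univ a),
        ← Finset.add_sum_erase _ _ (Finset.mem_erase.2 ⟨hab.symm, Finset.mem_univ b⟩)]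
      simp [cliqueInd, hap, haq, hbp, hbq, add_assoc]
    have hrest : 0 ≤ ∑ u ∈ (Finset.univ.erase a).erase b,
        (cliqueInd p q u).re * Complex.normSq (y u) := Finset.sum_nonneg fun u _ => hind u
    have hd := Complex.normSq_nonneg (y a - (g - 1) * y b)
    rw [hsq, hsplit] at hcon
    have e1 : ∑ u ∈ (Finset.univ.erase a).erase b,
        (cliqueInd p q u).re * Complex.normSq (y u) = 0 := by linarith
    have e2 : y a - (g - 1) * y b = 0 := Complex.normSq_eq_zero.1 (by linarith)
    have e3 : y q = 0 := Complex.normSq_eq_zero.1 (by linarith)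
    have e4 := (Finset.sum_eq_zero_iff_of_nonneg fun u _ => hind u).1 e1
    have e5 : ∀ u, u ≠ a → u ≠ b → cliqueInd p q u * y u = 0 := by
      intro u hu hu'
      have := e4 u (by simp [hu, hu'])
      unfold cliqueInd at this ⊢
      split_ifs at this ⊢ with h
      · simp
      · simpa using this
    have e6 : y a + y b = 0 := by
      rw [cliqueSum_apply, ← Finset.add_sum_erase _ _ (Finset.mem_univ a),
        ← Finset.add_sum_erase _ _ (Finset.mem_erase.2 ⟨hab.symm, Finset.mem_univ b⟩),
        Finset.sum_eq_zero (s := (Finset.univ.erase a).erase b)] at hS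
      · simpa [cliqueInd, hap, haq, hbp, hbq] using hS
      · intro u hu
        simp only [Finset.mem_erase, Finset.mem_univ, and_true] at hu
        exact e5 u hu.2 hu.1
    -- `y a = (g - 1) y b` and `y a = -y b` together give `g * y b = 0`.
    have e7 : y b = 0 := by
      have : g * y b = 0 := by linear_combination e6 - e2
      simpa [hg0] using this
    have e8 : y a = 0 := by rw [e7] at e6; simpa using e6
    refine hfin (fun u hu hu' => ?_) e3
    by_cases h1 : u = a
    · rw [h1, e8]
    · by_cases h2 : u = b
      · rw [h2, e7]
      · simpa [cliqueInd, hu, hu'] using e5 u h1 h2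

/-- The shift by the identity cancels the clique norm and completes a square on `p, q`. What remains
is two squares and two cross terms; negative directions of this form count eigenvalues below -1. -/
lemma kiteMatrix_form_add_re {p q : V} (hpq : p ≠ q) (z a b : V) {g : ℂ} (hg : star g = g⁻¹)
    (y : V → ℂ) :
    (star y ⬝ᵥ (kiteMatrix p q z a b g *ᵥ y)).re + (star y ⬝ᵥ y).re =
      Complex.normSq (cliqueSum p q y) + Complex.normSq (y p + y q)
      + 2 * (star (y a) * ((g - 1) * y b)).re + 2 * (star (y q) * y z).re := by
  rw [kiteMatrix_form_re _ _ _ _ _ hg, star_dotProduct_self_re hpq]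
  simp only [Complex.normSq_apply, Complex.add_re, Complex.add_im, Complex.mul_re,
    RCLike.star_def, Complex.conj_re, Complex.conj_im]
  ring

/-- The vectors spanning a plane on which the form of a kite matrix plus the identity is negative
definite. -/
noncomputable def negPlane (p q z a b r : V) (s : ℂ) : (Fin 2 → ℂ) →ₗ[ℂ] (V → ℂ) where
  toFun c u := c 0 * (if u = q then 1 else 0) - c 0 * (if u = p then 1 else 0)
    - c 0 * (if u = z then 1 else 0) + s * c 1 * (if u = a then 1 else 0)
    + c 1 * (if u = b then 1 else 0) + (c 0 - (s + 1) * c 1) * (if u = r then 1 else 0)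
  map_add' c d := by ext u; simp only [Pi.add_apply]; ring
  map_smul' t c := by ext u; simp only [Pi.smul_apply, smul_eq_mul, RingHom.id_apply]; ring

/-- An oriented edge at the attachment vertex cannot be traded for one away from it. -/
lemma not_unitarilyEquiv_kiteMatrix {W : Type*} [Fintype W] [DecidableEq W] {p q z b : V}
    {p' q' z' a' b' r' : W} {g g' : ℂ} (hpq : p ≠ q) (hg : g + g⁻¹ = 1) (hg' : g' + g'⁻¹ = 1)
    (hd : [p', q', z', a', b', r'].Nodup) :
    ¬ UnitarilyEquiv (kiteMatrix p q z z b g) (kiteMatrix p' q' z' a' b' g') := by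
  intro h
  have hgs := star_eq_inv_of_pow_six (sixth_root_of_add_inv hg)
  have hgs' := star_eq_inv_of_pow_six (sixth_root_of_add_inv hg')
  -- The single condition `y z = 0` kills both cross terms when the oriented edge is at `z`, so the
  -- shifted form is nonnegative on a hyperplane. It therefore cannot be negative definite on a
  -- plane.
  obtain ⟨c, hc, y, hy, hf, hn⟩ := h.exists_ne_zero (k := 1)
    (LinearMap.pi fun _ => LinearMap.proj z) (negPlane p' q' z' a' b' r' (1 - g'))
  have hyz : y z = 0 := congrFun hy 0
  have h1 := kiteMatrix_form_add_re hpq z z b hgs y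
  rw [hyz] at h1
  simp only [star_zero, zero_mul, mul_zero, Complex.zero_re, add_zero] at h1
  simp only [List.nodup_cons, List.mem_cons, List.not_mem_nil, or_false, not_or,
    List.nodup_nil, not_false_eq_true, and_true] at hd
  obtain ⟨⟨h12, h13, h14, h15, h16⟩, ⟨h23, h24, h25, h26⟩, ⟨h34, h35, h36⟩, ⟨h45, h46⟩, h56⟩ := hd
  have h2 := kiteMatrix_form_add_re h12 z' a' b' hgs' (negPlane p' q' z' a' b' r' (1 - g') c)
  -- The coefficient at `r'` is chosen to cancel the clique sum; this is why a fourth clique vertex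
  -- is needed.
  have hS : cliqueSum p' q' (negPlane p' q' z' a' b' r' (1 - g') c) = 0 := by
    rw [cliqueSum_apply]
    simp only [negPlane, LinearMap.coe_mk, AddHom.coe_mk, mul_add, mul_sub,
      Finset.sum_add_distrib, Finset.sum_sub_distrib, mul_ite, mul_one, mul_zero,
      Finset.sum_ite_eq', Finset.mem_univ, if_true]
    simp [cliqueInd, Ne.symm h13, Ne.symm h14, Ne.symm h15, Ne.symm h16, Ne.symm h23, Ne.symm h24,
      Ne.symm h25, Ne.symm h26]
    ring
  have vp : negPlane p' q' z' a' b' r' (1 - g') c p' = - c 0 := by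
    simp [negPlane, h12, h13, h14, h15, h16]
  have vq : negPlane p' q' z' a' b' r' (1 - g') c q' = c 0 := by
    simp [negPlane, Ne.symm h12, h23, h24, h25, h26]
  have vz : negPlane p' q' z' a' b' r' (1 - g') c z' = - c 0 := by
    simp [negPlane, Ne.symm h13, Ne.symm h23, h34, h35, h36]
  have va : negPlane p' q' z' a' b' r' (1 - g') c a' = (1 - g') * c 1 := by
    simp [negPlane, Ne.symm h14, Ne.symm h24, Ne.symm h34, h45, h46]
  have vb : negPlane p' q' z' a' b' r' (1 - g') c b' = c 1 := by
    simp [negPlane, Ne.symm h15, Ne.symm h25, Ne.symm h35, Ne.symm h45, h56]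
  rw [hS, vp, vq, vz, va, vb] at h2
  have e1 : star ((1 - g') * c 1) * ((g' - 1) * c 1) = ((-Complex.normSq (c 1) : ℝ) : ℂ) := by
    have hg0 : g' ≠ 0 := by rintro rfl; simp at hg'
    have : star (1 - g') * (g' - 1) = -1 := by
      rw [star_sub, star_one, hgs']
      field_simp at hg' ⊢
      linear_combination hg'
    rw [Complex.ofReal_neg, Complex.normSq_eq_conj_mul_self, star_mul']
    change _ = -(star (c 1) * c 1)
    linear_combination (star (c 1) * c 1) * this
  have e2 : star (c 0) * -c 0 = ((-Complex.normSq (c 0) : ℝ) : ℂ) := by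
    rw [Complex.ofReal_neg, Complex.normSq_eq_conj_mul_self, mul_neg]
    rfl
  rw [e1, e2, Complex.ofReal_re, Complex.ofReal_re, neg_add_cancel, map_zero, ← hf,
    ← hn, h1] at h2
  have n1 := Complex.normSq_nonneg (cliqueSum p q y)
  have n2 := Complex.normSq_nonneg (y p + y q)
  have n3 := Complex.normSq_nonneg (c 0)
  have n4 := Complex.normSq_nonneg (c 1)
  have z0 : c 0 = 0 := Complex.normSq_eq_zero.1 (by linarith)
  have z1 : c 1 = 0 := Complex.normSq_eq_zero.1 (by linarith)
  apply hc
  ext i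
  fin_cases i
  · exact z0
  · exact z1

/-! ### Traces of cubes of perturbed complete graphs. -/

/-- The cube of a perturbation of the adjacency matrix of a complete graph. -/
lemma trace_complete_add_pow_three {α R : Type*} [Fintype α] [DecidableEq α] [CommRing R]
    (M : Matrix α α R) :
    ((Matrix.of (fun _ _ => (1 : R)) - 1 + M) ^ 3).trace =
      (Fintype.card α : R) * (Fintype.card α - 1) * (Fintype.card α - 2)
      + 3 * ((Fintype.card α - 2) * ∑ i, ∑ j, M i j + M.trace)
      + 3 * (∑ i, ∑ j, (M * M) i j - (M * M).trace) + (M * M * M).trace := by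
  set J : Matrix α α R := Matrix.of (fun _ _ => (1 : R)) with hJ
  have hJJ : J * J = (Fintype.card α : R) • J := by
    ext i j; simp [hJ, Matrix.mul_apply]
  have htr : ∀ N : Matrix α α R, (J * N).trace = ∑ i, ∑ j, N i j := by
    intro N
    simp only [hJ, Matrix.trace, Matrix.diag_apply, Matrix.mul_apply, Matrix.of_apply, one_mul]
    exact Finset.sum_comm
  have hJt : J.trace = Fintype.card α := by simp [hJ, Matrix.trace]
  have hexp : (J - 1 + M) ^ 3 = J * J * J - 3 • (J * J) + 3 • J - 1
      + (J * J * M + J * M * J + M * J * J) - 3 • (J * M) - 3 • (M * J)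
      + (J * M * M + M * J * M + M * M * J) + 3 • M - 3 • (M * M) + M * M * M := by
    noncomm_ring
  -- Cyclicity of the trace reduces every mixed word to `J * J * M`, `J * M * M` or `J * M`.
  have c1 : (J * M * J).trace = (J * J * M).trace := Matrix.trace_mul_cycle J M J
  have c2 : (M * J * J).trace = (J * J * M).trace := (Matrix.trace_mul_cycle J J M).symm
  have c3 : (M * J * M).trace = (J * M * M).trace := by
    rw [Matrix.trace_mul_cycle M J M, Matrix.trace_mul_cycle M M J]
  have c4 : (M * M * J).trace = (J * M * M).trace := by
    rw [Matrix.trace_mul_cycle M M J]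
  have c5 : (M * J).trace = (J * M).trace := Matrix.trace_mul_comm _ _
  rw [hexp]
  simp only [Matrix.trace_add, Matrix.trace_sub, Matrix.trace_smul, c1, c2, c3, c4, c5,
    Matrix.trace_one]
  simp only [hJJ, Matrix.smul_mul, Matrix.trace_smul, Matrix.mul_assoc J M M, htr, hJt,
    nsmul_eq_mul, smul_eq_mul]
  push_cast
  ring

lemma trace_pow_three {α R : Type*} [Fintype α] [DecidableEq α] [CommRing R]
    (M : Matrix α α R) : (M ^ 3).trace = ∑ i, ∑ j, ∑ k, M i j * M j k * M k i := by
  rw [pow_succ, pow_two]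
  simp only [Matrix.trace, Matrix.diag_apply, Matrix.mul_apply, Finset.sum_mul]
  refine Finset.sum_congr rfl fun i _ => ?_
  rw [Finset.sum_comm]

/-- The matrix of a complete graph in which the arc `ab` has gain `g` and all edges other than `ab`
have gain `1`. -/
noncomputable def cliqueMatrix {α : Type*} [DecidableEq α] (a b : α) (g : ℂ) : Matrix α α ℂ :=
  fun i j => if i = j then 0 else if i = a ∧ j = b then g else if i = b ∧ j = a then g⁻¹ else 1

/-- The perturbation `R` of the complete graph lives on the two arcs of `ab`: `R * R` is diagonal
and `R * R * R` is traceless, so only the term linear in `R` contributes. -/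
lemma trace_cliqueMatrix_pow_three {α : Type*} [Fintype α] [DecidableEq α] {a b : α} (hab : a ≠ b)
    (g : ℂ) : (cliqueMatrix a b g ^ 3).trace =
      (Fintype.card α : ℂ) * (Fintype.card α - 1) * (Fintype.card α - 2)
      + 3 * (Fintype.card α - 2) * (g + g⁻¹ - 2) := by
  let R : Matrix α α ℂ := Matrix.single a b (g - 1) + Matrix.single b a (g⁻¹ - 1)
  have hKR : cliqueMatrix a b g = Matrix.of (fun _ _ => (1 : ℂ)) - 1 + R := by
    ext i j
    by_cases hij : i = j
    · subst hij
      have h1 : R i i = 0 := by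
        simp only [R, Matrix.add_apply, Matrix.single_apply]
        rw [if_neg (by grind), if_neg (by grind), add_zero]
      simp [cliqueMatrix, h1]
    · simp only [cliqueMatrix, R, Matrix.add_apply, Matrix.sub_apply, Matrix.single_apply,
        Matrix.of_apply, Matrix.one_apply_ne hij, if_neg hij]
      by_cases c1 : i = a ∧ j = b
      · obtain ⟨rfl, rfl⟩ := c1
        simp [hab]
      · by_cases c2 : i = b ∧ j = a
        · obtain ⟨rfl, rfl⟩ := c2
          simp [hab]
        · rw [if_neg c1, if_neg c2, if_neg (by tauto), if_neg (by tauto)]; simp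
  have hR1 : ∑ i, ∑ j, R i j = (g - 1) + (g⁻¹ - 1) := by
    simp [R, Finset.sum_add_distrib, Matrix.single_apply, ite_and]
  have hR2 : R.trace = 0 := by
    simp [R, hab, hab.symm]
  have hRR : R * R = Matrix.single a a ((g - 1) * (g⁻¹ - 1)) +
      Matrix.single b b ((g⁻¹ - 1) * (g - 1)) := by
    simp [R, add_mul, mul_add, hab, hab.symm, add_comm]
  have hR3 : ∑ i, ∑ j, (R * R) i j - (R * R).trace = 0 := by
    rw [hRR]
    simp [Finset.sum_add_distrib, Matrix.single_apply, ite_and]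
  have hR4 : (R * R * R).trace = 0 := by
    rw [hRR]
    simp [R, add_mul, mul_add, hab, hab.symm]
  rw [hKR, trace_complete_add_pow_three, hR1, hR2, hR3, hR4]
  ring

/-! ### Unbalanced triangles in a clique with gains. -/

/-- A family of at most `m - 2` triples in an `m`-set with the property that a triple in the family
and a further vertex always span a second triple of the family: all triples share a pair. -/
lemma exists_pair_subset_of_tetrahedra {α : Type*} [Fintype α] [DecidableEq α]
    (U : Finset (Finset α)) (h3 : ∀ s ∈ U, s.card = 3)
    (hcard : U.card ≤ Fintype.card α - 2) (hU : U.Nonempty)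
    (htet : ∀ s ∈ U, ∀ d ∉ s, ∃ v ∈ s, insert d (s.erase v) ∈ U) :
    ∃ a b, a ≠ b ∧ ∀ s ∈ U, a ∈ s ∧ b ∈ s := by
  obtain ⟨T, hT⟩ := hU
  have hT3 := h3 T hT
  choose! φ hφ hφU using htet T hT
  -- `c d` is a second triple of the family inside `T ∪ {d}`, and it leaves `T` only in `d`. So `T`
  -- and the `c d` are already `card α - 2` distinct triples, and they exhaust `U`.
  let c : α → Finset α := fun d => insert d (T.erase (φ d))
  have hmem : ∀ d ∉ T, ∀ e ∉ T, e ∈ c d ↔ e = d := by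
    intro d hd e he
    simp [c, he]
  have hinj : Set.InjOn c (Tᶜ : Finset α) := by
    intro d hd e he hde
    simp only [Finset.coe_compl, Set.mem_compl_iff, Finset.mem_coe] at hd he
    have := (hmem d hd d hd).2 rfl
    rw [hde, hmem e he d hd] at this
    exact this
  have hTc : T ∉ (Tᶜ).image c := by
    intro h
    obtain ⟨d, hd, hdc⟩ := Finset.mem_image.1 h
    rw [Finset.mem_compl] at hd
    exact hd (hdc ▸ Finset.mem_insert_self _ _)
  have hsub : insert T ((Tᶜ).image c) ⊆ U := by
    intro s hs
    rcases Finset.mem_insert.1 hs with rfl | hs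
    · exact hT
    · obtain ⟨d, hd, rfl⟩ := Finset.mem_image.1 hs
      exact hφU d (Finset.mem_compl.1 hd)
  have hle : T.card ≤ Fintype.card α := Finset.card_le_univ T
  have hUeq : insert T ((Tᶜ).image c) = U := by
    refine Finset.eq_of_subset_of_card_le hsub ?_
    rw [Finset.card_insert_of_notMem hTc, Finset.card_image_of_injOn hinj, Finset.card_compl]
    omega
  -- Applying the tetrahedron property to `c d` and `e` yields a triple containing `e`, which can
  -- only be `c e`. As `d ∉ c e`, the removed vertex is `d`, so `c d` and `c e` rest on the same
  -- pair of `T`.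
  have hconst : ∀ d ∉ T, ∀ e ∉ T, φ d = φ e := by
    intro d hd e he
    by_cases hde : d = e
    · rw [hde]
    have hdU : c d ∈ U := hφU d hd
    have hec : e ∉ c d := fun h => hde ((hmem d hd e he).1 h).symm
    obtain ⟨w, hw, hwU⟩ := htet (c d) hdU e hec
    rw [← hUeq, Finset.mem_insert, Finset.mem_image] at hwU
    rcases hwU with h | ⟨f, hf, hfe⟩
    · exact absurd (h ▸ Finset.mem_insert_self _ _) he
    · rw [Finset.mem_compl] at hf
      have hef : e = f := (hmem f hf e he).1 (hfe ▸ Finset.mem_insert_self _ _)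
      subst hef
      have hdn : d ∉ c e := fun h => hde ((hmem e he d hd).1 h)
      have hwd : w = d := by
        by_contra hne
        apply hdn
        rw [hfe]
        exact Finset.mem_insert_of_mem
          (Finset.mem_erase.2 ⟨Ne.symm hne, Finset.mem_insert_self _ _⟩)
      subst hwd
      have hwT : w ∉ T.erase (φ w) := fun h => hd (Finset.mem_of_mem_erase h)
      have h1 : (c w).erase w = T.erase (φ w) := Finset.erase_insert hwT
      rw [h1] at hfe
      have h2 : T.erase (φ e) = T.erase (φ w) := by
        have e1 : e ∉ T.erase (φ e) := fun h => he (Finset.mem_of_mem_erase h)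
        have e2 : e ∉ T.erase (φ w) := fun h => he (Finset.mem_of_mem_erase h)
        have := congrArg (fun s => Finset.erase s e) hfe
        simpa [c, Finset.erase_insert e1, Finset.erase_insert e2] using this
      by_contra hne
      have : φ w ∈ T.erase (φ e) := Finset.mem_erase.2 ⟨hne, hφ w hd⟩
      rw [h2] at this
      simp at this
  obtain ⟨v, hv, hvc⟩ : ∃ v ∈ T, ∀ d ∉ T, φ d = v := by
    by_cases h : ∃ d, d ∉ T
    · obtain ⟨d, hd⟩ := h
      exact ⟨φ d, hφ d hd, fun e he => hconst e he d hd⟩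
    · push Not at h
      obtain ⟨v, hv⟩ := Finset.card_pos.1 (by omega : 0 < T.card)
      exact ⟨v, hv, fun d hd => absurd (h d) hd⟩
  have h2 : (T.erase v).card = 2 := by rw [Finset.card_erase_of_mem hv, hT3]
  obtain ⟨a, b, hab, hTab⟩ := Finset.card_eq_two.1 h2
  have ha : a ∈ T.erase v := by simp [hTab]
  have hb : b ∈ T.erase v := by simp [hTab]
  refine ⟨a, b, hab, fun s hs => ?_⟩
  rw [← hUeq, Finset.mem_insert, Finset.mem_image] at hs
  rcases hs with rfl | ⟨d, hd, rfl⟩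
  · exact ⟨Finset.mem_of_mem_erase ha, Finset.mem_of_mem_erase hb⟩
  · simp only [c, hvc d (Finset.mem_compl.1 hd)]
    exact ⟨Finset.mem_insert_of_mem ha, Finset.mem_insert_of_mem hb⟩

/-- A gain matrix on a complete graph. -/
structure IsCliqueGain {α : Type*} (K : Matrix α α ℂ) : Prop where
  diag : ∀ i, K i i = 0
  pow_six : ∀ i j, i ≠ j → K i j ^ 6 = 1
  inv : ∀ i j, i ≠ j → K j i = (K i j)⁻¹

/-- The sixth roots of unity other than 1 have real part -1, -1/2 or 1/2. The gap of 1/2 is the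
least that an unbalanced triangle costs in the trace of the cube. -/
lemma re_le_half_of_pow_six {g : ℂ} (hg : g ^ 6 = 1) (h1 : g ≠ 1) : g.re ≤ 1 / 2 := by
  have hs := star_eq_inv_of_pow_six hg
  have h0 : g ≠ 0 := by rintro rfl; simp at hg
  have hprod : (g - 1) * ((g + 1) * ((g ^ 2 + g + 1) * (g ^ 2 - g + 1))) = 0 := by
    linear_combination hg
  have hre : g + g⁻¹ = ((2 * g.re : ℝ) : ℂ) := by
    rw [← hs]; exact Complex.add_conj g
  rcases mul_eq_zero.1 hprod with h | h
  · exact absurd (sub_eq_zero.1 h) h1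
  rcases mul_eq_zero.1 h with h | h
  · rw [eq_neg_of_add_eq_zero_left h]; norm_num
  rcases mul_eq_zero.1 h with h | h
  · have : g + g⁻¹ = ((-1 : ℝ) : ℂ) := by
      push_cast
      field_simp
      linear_combination h
    have := Complex.ofReal_injective (hre.symm.trans this)
    linarith
  · have : g + g⁻¹ = ((1 : ℝ) : ℂ) := by
      push_cast
      field_simp
      linear_combination h
    have := Complex.ofReal_injective (hre.symm.trans this)
    linarith

namespace IsCliqueGain

variable {α : Type*} [Fintype α] [DecidableEq α] {K : Matrix α α ℂ}

omit [Fintype α] [DecidableEq α] in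
lemma ne_zero (hK : IsCliqueGain K) {i j : α} (h : i ≠ j) : K i j ≠ 0 := by
  intro h0
  have := hK.pow_six i j h
  simp [h0] at this

/-- The ordered unbalanced triangles. -/
noncomputable def unbalanced (K : Matrix α α ℂ) : Finset (α × α × α) :=
  open Classical in Finset.univ.filter fun t =>
    t.1 ≠ t.2.1 ∧ t.2.1 ≠ t.2.2 ∧ t.2.2 ≠ t.1 ∧ K t.1 t.2.1 * K t.2.1 t.2.2 * K t.2.2 t.1 ≠ 1

lemma mem_unbalanced {i j k : α} : (i, j, k) ∈ unbalanced K ↔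
    i ≠ j ∧ j ≠ k ∧ k ≠ i ∧ K i j * K j k * K k i ≠ 1 := by
  simp [unbalanced]

lemma rotate {i j k : α} (h : (i, j, k) ∈ unbalanced K) : (j, k, i) ∈ unbalanced K := by
  rw [mem_unbalanced] at h ⊢
  refine ⟨h.2.1, h.2.2.1, h.1, fun h' => h.2.2.2 ?_⟩
  rw [← h']; ring

lemma swap (hK : IsCliqueGain K) {i j k : α} (h : (i, j, k) ∈ unbalanced K) :
    (j, i, k) ∈ unbalanced K := by
  rw [mem_unbalanced] at h ⊢
  obtain ⟨h1, h2, h3, h4⟩ := h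
  refine ⟨h1.symm, h3.symm, h2.symm, fun h' => h4 ?_⟩
  rw [hK.inv i j h1, hK.inv k i h3, hK.inv j k h2] at h'
  have := congrArg (·⁻¹) h'
  simp only [mul_inv, inv_inv, inv_one] at this
  rw [← this]; ring

/-- Compared termwise with all gains equal to 1, each ordered unbalanced triangle loses at least 1/2
in real part, and no term gains. -/
lemma card_unbalanced_le (hK : IsCliqueGain K) {t : ℝ}
    (hT : ((K ^ 3).trace).re = (Fintype.card α : ℝ) * (Fintype.card α - 1) * (Fintype.card α - 2)
      - t) : ((unbalanced K).card : ℝ) ≤ 2 * t := by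
  have hC := trace_complete_add_pow_three (0 : Matrix α α ℂ)
  rw [add_zero, trace_pow_three] at hC
  rw [trace_pow_three] at hT
  set C : Matrix α α ℂ := Matrix.of (fun _ _ => (1 : ℂ)) - 1 with hCdef
  have hCre := congrArg Complex.re hC
  have key : ∀ i j k, (if (i, j, k) ∈ unbalanced K then (1 / 2 : ℝ) else 0) ≤
      (C i j * C j k * C k i).re - (K i j * K j k * K k i).re := by
    intro i j k
    by_cases h1 : i = j
    · subst h1; simp [mem_unbalanced, hCdef, hK.diag]
    by_cases h2 : j = k
    · subst h2; simp [mem_unbalanced, hCdef, hK.diag]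
    by_cases h3 : k = i
    · subst h3; simp [mem_unbalanced, hCdef, hK.diag]
    have hc : C i j * C j k * C k i = 1 := by simp [hCdef, h1, h2, h3]
    rw [hc]
    by_cases h4 : K i j * K j k * K k i = 1
    · rw [h4, if_neg (by simp [mem_unbalanced, h4])]; simp
    · rw [if_pos (mem_unbalanced.2 ⟨h1, h2, h3, h4⟩)]
      have := re_le_half_of_pow_six (by
        rw [mul_pow, mul_pow, hK.pow_six i j h1, hK.pow_six j k h2, hK.pow_six k i h3]; simp) h4
      simp only [Complex.one_re]
      linarith
  have hsum := Finset.sum_le_sum fun i (_ : i ∈ Finset.univ) =>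
    Finset.sum_le_sum fun j (_ : j ∈ Finset.univ) =>
      Finset.sum_le_sum fun k (_ : k ∈ Finset.univ) => key i j k
  have hleft : ∑ i, ∑ j, ∑ k, (if (i, j, k) ∈ unbalanced K then (1 / 2 : ℝ) else 0) =
      (unbalanced K).card / 2 := by
    have : ∑ x : α × α × α, (if x ∈ unbalanced K then (1 / 2 : ℝ) else 0) =
        (unbalanced K).card / 2 := by
      rw [Finset.sum_ite_mem]; simp [div_eq_mul_inv]
    rw [← this, Fintype.sum_prod_type]
    refine Finset.sum_congr rfl fun i _ => ?_
    rw [Fintype.sum_prod_type]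
  rw [hleft] at hsum
  simp only [Finset.sum_sub_distrib, ← Complex.re_sum] at hsum
  rw [hCre, hT] at hsum
  simp at hsum
  linarith

/-- The vertex sets of the unbalanced triangles. -/
noncomputable def unbalancedSets (K : Matrix α α ℂ) : Finset (Finset α) :=
  (unbalanced K).image fun t => {t.1, t.2.1, t.2.2}

lemma six_mul_card_unbalancedSets_le (hK : IsCliqueGain K) :
    6 * (unbalancedSets K).card ≤ (unbalanced K).card := by
  rw [mul_comm, Finset.card_eq_sum_card_image (fun t : α × α × α => ({t.1, t.2.1, t.2.2} : Finset α))
    (unbalanced K), ← smul_eq_mul]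
  refine Finset.card_nsmul_le_sum _ _ _ fun s hs => ?_
  obtain ⟨⟨i, j, k⟩, ht, rfl⟩ := Finset.mem_image.1 hs
  have h1 := rotate ht
  have h2 := rotate h1
  have h3 := swap hK ht
  have h4 := rotate h3
  have h5 := rotate h4
  obtain ⟨hij, hjk, hki, -⟩ := mem_unbalanced.1 ht
  have hsub : ({(i, j, k), (j, k, i), (k, i, j), (j, i, k), (i, k, j), (k, j, i)} :
      Finset (α × α × α)) ⊆ (unbalanced K).filter fun t =>
        ({t.1, t.2.1, t.2.2} : Finset α) = {i, j, k} := by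
    intro t ht'
    simp only [Finset.mem_insert, Finset.mem_singleton] at ht'
    rw [Finset.mem_filter]
    rcases ht' with rfl | rfl | rfl | rfl | rfl | rfl <;>
      refine ⟨by assumption, ?_⟩ <;> ext x <;> simp <;> tauto
  refine le_trans (le_of_eq ?_) (Finset.card_le_card hsub)
  simp [Finset.card_insert_of_notMem, hij, hjk, hki, Ne.symm hij, Ne.symm hjk, Ne.symm hki]

lemma mem_unbalanced_of_mem_sets (hK : IsCliqueGain K) {i j k : α} (hij : i ≠ j) (hjk : j ≠ k)
    (hki : k ≠ i) : ({i, j, k} : Finset α) ∈ unbalancedSets K ↔ (i, j, k) ∈ unbalanced K := by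
  constructor
  · intro h
    obtain ⟨⟨a, b, c⟩, ht, he⟩ := Finset.mem_image.1 h
    have h1 := rotate ht
    have h2 := rotate h1
    have h3 := swap hK ht
    have h4 := rotate h3
    have h5 := rotate h4
    have hi : i ∈ ({a, b, c} : Finset α) := by rw [he]; simp
    have hj : j ∈ ({a, b, c} : Finset α) := by rw [he]; simp
    have hk : k ∈ ({a, b, c} : Finset α) := by rw [he]; simp
    simp only [Finset.mem_insert, Finset.mem_singleton] at hi hj hk
    rcases hi with rfl | rfl | rfl <;> rcases hj with rfl | rfl | rfl <;>
      rcases hk with rfl | rfl | rfl <;> first | assumption | exact absurd rfl ‹_›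
  · intro h
    exact Finset.mem_image.2 ⟨_, h, rfl⟩

/-- In a tetrahedron the gain of one face is the product of the gains of the other three, suitably
oriented, so three balanced faces force the fourth to be balanced. -/
lemma unbalancedSets_tetrahedra (hK : IsCliqueGain K) :
    ∀ s ∈ unbalancedSets K, ∀ d ∉ s, ∃ v ∈ s, insert d (s.erase v) ∈ unbalancedSets K := by
  intro s hs d hd
  obtain ⟨⟨i, j, k⟩, ht, rfl⟩ := Finset.mem_image.1 hs
  obtain ⟨hij, hjk, hki, hne⟩ := mem_unbalanced.1 ht
  simp only [Finset.mem_insert, Finset.mem_singleton, not_or] at hd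
  obtain ⟨hdi, hdj, hdk⟩ := hd
  by_contra hcon
  push Not at hcon
  have e1 : (({i, j, k} : Finset α)).erase i = {j, k} := by
    ext x; simp only [Finset.mem_erase, Finset.mem_insert, Finset.mem_singleton]; grind
  have e2 : (({i, j, k} : Finset α)).erase j = {k, i} := by
    ext x; simp only [Finset.mem_erase, Finset.mem_insert, Finset.mem_singleton]; grind
  have e3 : (({i, j, k} : Finset α)).erase k = {i, j} := by
    ext x; simp only [Finset.mem_erase, Finset.mem_insert, Finset.mem_singleton]; grind
  have c1 := hcon i (by simp)
  have c2 := hcon j (by simp)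
  have c3 := hcon k (by simp)
  simp only [e1, e2, e3] at c1 c2 c3
  rw [mem_unbalanced_of_mem_sets hK hdj hjk (Ne.symm hdk), mem_unbalanced] at c1
  rw [mem_unbalanced_of_mem_sets hK hdk hki (Ne.symm hdi), mem_unbalanced] at c2
  rw [mem_unbalanced_of_mem_sets hK hdi hij (Ne.symm hdj), mem_unbalanced] at c3
  have d1 : K d j * K j k * K k d = 1 := by
    by_contra h; exact c1 ⟨hdj, hjk, Ne.symm hdk, h⟩
  have d2 : K d k * K k i * K i d = 1 := by
    by_contra h; exact c2 ⟨hdk, hki, Ne.symm hdi, h⟩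
  have d3 : K d i * K i j * K j d = 1 := by
    by_contra h; exact c3 ⟨hdi, hij, Ne.symm hdj, h⟩
  rw [hK.inv d k hdk] at d1
  rw [hK.inv d i hdi] at d2
  rw [hK.inv d j hdj] at d3
  have n1 := hK.ne_zero hdi
  have n2 := hK.ne_zero hdj
  have n3 := hK.ne_zero hdk
  apply hne
  calc K i j * K j k * K k i = (K d j * K j k * (K d k)⁻¹) * (K d k * K k i * (K d i)⁻¹) *
        (K d i * K i j * (K d j)⁻¹) := by field_simp
    _ = 1 := by rw [d1, d2, d3]; norm_num

/-- Switching makes every edge at `r` have gain 1; any other edge `ij` then carries the gain of the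
triangle `ijr`. Taking `a = b` encodes that there is no exceptional edge. -/
lemma exists_switching (hK : IsCliqueGain K) (a b : α)
    (h : ∃ r, (a = b ∨ r ≠ a ∧ r ≠ b) ∧ ∀ i j, i ≠ j → i ≠ r → j ≠ r → ¬(i = a ∧ j = b) →
      ¬(i = b ∧ j = a) → (i, j, r) ∉ unbalanced K) :
    ∃ (x : α → ℂ) (g : ℂ), (∀ i, x i ^ 6 = 1) ∧ (a = b → g = 1) ∧ (a ≠ b → g ≠ 0) ∧
      ∀ i j, i ≠ j → K i j = x i * (if i = a ∧ j = b then g else if i = b ∧ j = a then g⁻¹ else 1)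
        * (x j)⁻¹ := by
  obtain ⟨r, hr, h⟩ := h
  let x : α → ℂ := fun i => if i = r then 1 else K i r
  have hx6 : ∀ i, x i ^ 6 = 1 := by
    intro i
    by_cases hi : i = r
    · simp [x, hi]
    · simpa [x, hi] using hK.pow_six i r hi
  have hx0 : ∀ i, x i ≠ 0 := by
    intro i h0
    have := hx6 i
    simp [h0] at this
  refine ⟨x, if a = b then 1 else (x a)⁻¹ * K a b * x b, hx6, fun hab => if_pos hab, ?_, ?_⟩
  · intro hab
    rw [if_neg hab]
    exact mul_ne_zero (mul_ne_zero (inv_ne_zero (hx0 a)) (hK.ne_zero hab)) (hx0 b)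
  intro i j hij
  by_cases h1 : i = a ∧ j = b
  · obtain ⟨rfl, rfl⟩ := h1
    have := hx0 i
    have := hx0 j
    simp only [and_self, if_true, if_neg hij]
    field_simp
  by_cases h2 : i = b ∧ j = a
  · obtain ⟨rfl, rfl⟩ := h2
    have := hx0 i
    have := hx0 j
    rw [if_neg h1, if_pos ⟨rfl, rfl⟩, if_neg (Ne.symm hij), hK.inv j i (Ne.symm hij)]
    field_simp
  rw [if_neg h1, if_neg h2]
  by_cases hi : i = r
  · subst hi
    have : j ≠ i := Ne.symm hij
    simp [x, this, hK.inv j i this]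
  by_cases hj : j = r
  · subst hj
    simp [x, hi]
  · have hb : K i j * K j r * K r i = 1 := by
      by_contra hne
      exact h i j hij hi hj h1 h2 (mem_unbalanced.2 ⟨hij, hj, Ne.symm hi, hne⟩)
    simp only [x, hi, hj, if_false]
    rw [hK.inv i r hi] at hb
    have n1 := hK.ne_zero hi
    have n2 := hK.ne_zero hj
    field_simp at hb ⊢
    exact hb

lemma balanced_of_trace (hK : IsCliqueGain K) (z : α) (hT : (K ^ 3).trace =
      (Fintype.card α : ℂ) * (Fintype.card α - 1) * (Fintype.card α - 2)) :
    ∃ x : α → ℂ, (∀ i, x i ^ 6 = 1) ∧ ∀ i j, i ≠ j → K i j = x i * (x j)⁻¹ := by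
  have hT' := congrArg Complex.re hT
  have h1 := card_unbalanced_le hK (t := 0) (by
    rw [hT']; simp)
  have h2 : unbalanced K = ∅ := by
    rw [← Finset.card_eq_zero]
    have : ((unbalanced K).card : ℝ) ≤ 0 := by simpa using h1
    exact_mod_cast le_antisymm this (Nat.cast_nonneg _)
  obtain ⟨x, g, hx, hg, -, h⟩ := hK.exists_switching z z ⟨z, Or.inl rfl, by simp [h2]⟩
  refine ⟨x, hx, fun i j hij => ?_⟩
  rw [h i j hij, hg rfl]
  simp

/-- A deficit of `3 * (card α - 2)` permits at most `card α - 2` unordered unbalanced triangles,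
which must share an edge `ab`. All other edges are switched to gain 1, and the trace then determines
`g + g⁻¹`. The alternative concerning `z` prepares for locating the edge. -/
lemma oriented_of_trace (hK : IsCliqueGain K) (z : α) (hcard : 3 ≤ Fintype.card α)
    (hT : (K ^ 3).trace =
      (Fintype.card α : ℂ) * (Fintype.card α - 1) * (Fintype.card α - 2)
      - 3 * (Fintype.card α - 2)) :
    ∃ (a b : α) (g : ℂ) (x : α → ℂ), a ≠ b ∧ g + g⁻¹ = 1 ∧
      (a = z ∨ ∃ r, [z, a, b, r].Nodup) ∧ (∀ i, x i ^ 6 = 1) ∧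
      ∀ i j, i ≠ j → K i j = x i * (if i = a ∧ j = b then g else if i = b ∧ j = a then g⁻¹ else 1)
        * (x j)⁻¹ := by
  have hT' := congrArg Complex.re hT
  have h1 := card_unbalanced_le hK (t := 3 * (Fintype.card α - 2)) (by
    rw [hT']; simp)
  have h2 : (unbalancedSets K).card ≤ Fintype.card α - 2 := by
    have h3 := hK.six_mul_card_unbalancedSets_le
    have h4 : (6 * (unbalancedSets K).card : ℝ) ≤ 2 * (3 * (Fintype.card α - 2)) :=
      le_trans (by exact_mod_cast h3) h1
    have h5 : ((unbalancedSets K).card : ℝ) + 2 ≤ Fintype.card α := by linarith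
    have h6 : (unbalancedSets K).card + 2 ≤ Fintype.card α := by exact_mod_cast h5
    omega
  have hcard' : (3 : ℂ) * (Fintype.card α - 2) ≠ 0 := by
    refine mul_ne_zero (by norm_num) (sub_ne_zero.2 ?_)
    norm_cast
    omega
  have hpair : ∃ a b, a ≠ b ∧ ∀ s ∈ unbalancedSets K, a ∈ s ∧ b ∈ s := by
    by_cases hne : (unbalancedSets K).Nonempty
    · refine exists_pair_subset_of_tetrahedra _ ?_ h2 hne hK.unbalancedSets_tetrahedra
      intro s hs
      obtain ⟨⟨i, j, k⟩, ht, rfl⟩ := Finset.mem_image.1 hs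
      obtain ⟨hij, hjk, hki, -⟩ := mem_unbalanced.1 ht
      exact Finset.card_eq_three.2 ⟨i, j, k, hij, hki.symm, hjk, rfl⟩
    -- With no unbalanced triangle any pair will serve here; the trace identity fixes `g` at the
    -- end.
    · rw [Finset.not_nonempty_iff_eq_empty] at hne
      obtain ⟨a, b, hab⟩ := Fintype.one_lt_card_iff.1 (by omega : 1 < Fintype.card α)
      exact ⟨a, b, hab, by simp [hne]⟩
  have hpair' : ∃ a b, a ≠ b ∧ (∀ s ∈ unbalancedSets K, a ∈ s ∧ b ∈ s) ∧
      (a = z ∨ ∃ r, [z, a, b, r].Nodup) := by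
    obtain ⟨a, b, hab, h⟩ := hpair
    by_cases haz : a = z
    · exact ⟨a, b, hab, h, Or.inl haz⟩
    by_cases hbz : b = z
    · exact ⟨b, a, hab.symm, fun s hs => (h s hs).symm, Or.inl hbz⟩
    by_cases h4 : ∃ r, r ∉ ({z, a, b} : Finset α)
    · obtain ⟨r, hr⟩ := h4
      simp only [Finset.mem_insert, Finset.mem_singleton, not_or] at hr
      refine ⟨a, b, hab, h, Or.inr ⟨r, ?_⟩⟩
      simp only [List.nodup_cons, List.mem_cons, List.not_mem_nil, or_false, not_or,
        List.nodup_nil, not_false_eq_true, and_true]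
      exact ⟨⟨Ne.symm haz, Ne.symm hbz, Ne.symm hr.1⟩, ⟨hab, Ne.symm hr.2.1⟩, Ne.symm hr.2.2⟩
    -- The clique is `{z, a, b}`, so the only possible unbalanced triangle is the whole clique and
    -- the pair can be moved to contain `z`.
    · push Not at h4
      refine ⟨z, b, Ne.symm hbz, fun s hs => ?_, Or.inl rfl⟩
      obtain ⟨⟨i, j, k⟩, ht, rfl⟩ := Finset.mem_image.1 hs
      obtain ⟨hij, hjk, hki, -⟩ := mem_unbalanced.1 ht
      refine ⟨?_, (h _ hs).2⟩
      have hs3 : ({i, j, k} : Finset α) = {z, a, b} := by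
        refine Finset.eq_of_subset_of_card_le (fun x _ => h4 x) ?_
        rw [Finset.card_eq_three.2 ⟨i, j, k, hij, hki.symm, hjk, rfl⟩]
        exact Finset.card_le_three
      rw [show ({(i, j, k).1, (i, j, k).2.1, (i, j, k).2.2} : Finset α) = {z, a, b} from hs3]
      simp
  obtain ⟨a, b, hab, h, hz⟩ := hpair'
  obtain ⟨r, hr⟩ : ∃ r, r ∉ ({a, b} : Finset α) := by
    by_contra hcon
    push Not at hcon
    have := Finset.card_le_card (fun x _ => hcon x : (Finset.univ : Finset α) ⊆ {a, b})
    have h2 : ({a, b} : Finset α).card ≤ 2 := Finset.card_le_two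
    rw [Finset.card_univ] at this
    omega
  simp only [Finset.mem_insert, Finset.mem_singleton, not_or] at hr
  -- As `r` is neither `a` nor `b`, an unbalanced triangle `ijr` has `{i, j} = {a, b}`.
  obtain ⟨x, g, hx, -, hg0, hxg⟩ := hK.exists_switching a b ⟨r, Or.inr hr, by
    intro i j hij hi hj n1 n2 hu
    have := h _ (Finset.mem_image.2 ⟨_, hu, rfl⟩)
    simp only [Finset.mem_insert, Finset.mem_singleton] at this
    obtain ⟨ha, hb⟩ := this
    have hr1 := hr.1
    have hr2 := hr.2
    grind⟩
  refine ⟨a, b, g, x, hab, ?_, hz, hx, hxg⟩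
  have hx0 : ∀ i, x i ≠ 0 := by
    intro i h0
    have := hx i
    simp [h0] at this
  have hg0 := hg0 hab
  have htr : (K ^ 3).trace = (cliqueMatrix a b g ^ 3).trace := by
    rw [trace_pow_three, trace_pow_three]
    refine Finset.sum_congr rfl fun i _ => Finset.sum_congr rfl fun j _ =>
      Finset.sum_congr rfl fun k _ => ?_
    have hKR : ∀ i j, K i j = x i * cliqueMatrix a b g i j * (x j)⁻¹ := by
      intro i j
      by_cases hij : i = j
      · subst hij
        simp [hK.diag, cliqueMatrix]
      · rw [hxg i j hij, cliqueMatrix, if_neg hij]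
    rw [hKR i j, hKR j k, hKR k i]
    have := hx0 i
    have := hx0 j
    have := hx0 k
    field_simp
  rw [htr, trace_cliqueMatrix_pow_three hab] at hT
  have : 3 * ((Fintype.card α : ℂ) - 2) * (g + g⁻¹ - 1) = 0 := by linear_combination hT
  have := (mul_eq_zero.1 this).resolve_left hcard'
  linear_combination this

end IsCliqueGain

/-! ### The extremal problem for triangle-free complements. -/

/-- `G` is a kite with clique `V ∖ {p, q}`, attachment vertex `z` and pendant path `z, q, p`. -/
structure IsKite {V : Type*} (G : SimpleGraph V) (p q z : V) : Prop where
  p_ne_q : p ≠ q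
  z_ne_p : z ≠ p
  z_ne_q : z ≠ q
  adj_p : ∀ w, G.Adj p w ↔ w = q
  adj_q : ∀ w, G.Adj q w ↔ w = p ∨ w = z
  clique : ∀ u v, u ≠ p → u ≠ q → v ≠ p → v ≠ q → u ≠ v → G.Adj u v

/-- The adjacency matrix of the graph obtained by joining two disjoint triangles `1 2 3` and
`0 4 5` by the edges `25` and `35`. -/
def linkedTriangles : Fin 6 → Fin 6 → ℕ :=
  ![![0, 0, 0, 0, 1, 1],
    ![0, 0, 1, 1, 0, 0],
    ![0, 1, 0, 1, 0, 1],
    ![0, 1, 1, 0, 0, 1],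
    ![1, 0, 0, 0, 0, 1],
    ![1, 0, 1, 1, 1, 0]]

section Graph

variable {V : Type*} [Fintype V] [DecidableEq V] {H : SimpleGraph V} [DecidableRel H.Adj] {m : ℕ}

omit [DecidableEq V] in
lemma sum_neighbor_degree (H : SimpleGraph V) [DecidableRel H.Adj] :
    ∑ u, ∑ v ∈ H.neighborFinset u, H.degree v = ∑ u, H.degree u ^ 2 := by
  rw [Finset.sum_comm' (t' := Finset.univ) (s' := fun v => H.neighborFinset v)]
  · simp [pow_two]
  · simp [H.adj_comm]

/-- If `d(u) + d(v) ≤ m + 1` on every edge, summing over darts gives `∑ d² ≤ (m + 1)(2m - 1) = 2m² +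
m - 1`, one too small. An edge with a larger degree sum has disjoint neighbourhoods that fill all `m
+ 2` vertices. -/
lemma exists_dominating_edge (hV : Fintype.card V = m + 2)
    (htf : ∀ u v w, H.Adj u v → H.Adj v w → ¬ H.Adj u w)
    (hsum : ∑ u, H.degree u + 2 = 4 * m) (hsq : 2 * m ^ 2 + m ≤ ∑ u, H.degree u ^ 2) :
    ∃ u v, H.Adj u v ∧ ∀ w, H.Adj u w ↔ ¬ H.Adj v w := by
  by_contra hcon
  push Not at hcon
  have hle : ∀ u v, H.Adj u v → H.degree u + H.degree v ≤ m + 1 := by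
    intro u v huv
    by_contra hlt
    push Not at hlt
    have hdis : Disjoint (H.neighborFinset u) (H.neighborFinset v) := by
      rw [Finset.disjoint_left]
      intro w hw hw'
      rw [SimpleGraph.mem_neighborFinset] at hw hw'
      exact htf u v w huv hw' hw
    have huniv : H.neighborFinset u ∪ H.neighborFinset v = Finset.univ := by
      rw [← Finset.card_eq_iff_eq_univ]
      refine le_antisymm (Finset.card_le_univ _) ?_
      rw [Finset.card_union_of_disjoint hdis, hV, H.card_neighborFinset_eq_degree,
        H.card_neighborFinset_eq_degree]
      omega
    obtain ⟨w, hw⟩ := hcon u v huv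
    have h1 : w ∈ H.neighborFinset u ∪ H.neighborFinset v := by rw [huniv]; simp
    simp only [Finset.mem_union, SimpleGraph.mem_neighborFinset] at h1
    rcases hw with ⟨h2, h3⟩ | ⟨h2, h3⟩
    · exact htf u v w huv h3 h2
    · tauto
  have h1 : ∑ u, ∑ v ∈ H.neighborFinset u, (H.degree u + H.degree v) ≤
      ∑ u, ∑ v ∈ H.neighborFinset u, (m + 1) :=
    Finset.sum_le_sum fun u _ => Finset.sum_le_sum fun v hv =>
      hle u v ((H.mem_neighborFinset u v).1 hv)
  simp only [Finset.sum_add_distrib, sum_neighbor_degree, Finset.sum_const, smul_eq_mul,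
    H.card_neighborFinset_eq_degree, ← pow_two, mul_one, ← Finset.sum_mul] at h1
  have h2 : (∑ u, H.degree u) * m = (4 * m - 2) * m := by congr 1; omega
  have h3 : 1 ≤ m := by omega
  rw [h2] at h1
  obtain ⟨k, rfl⟩ := Nat.exists_eq_add_of_le' h3
  have h4 : 4 * (k + 1) - 2 = 4 * k + 2 := by omega
  rw [h4] at h1
  nlinarith

omit [DecidableEq V] in
/-- The two sides of a triangle-free graph with a dominating edge have the same number of edges. -/
lemma sum_degree_side {u v : V}
    (htf : ∀ u v w, H.Adj u v → H.Adj v w → ¬ H.Adj u w)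
    (hdom : ∀ w, H.Adj u w ↔ ¬ H.Adj v w) :
    ∑ i ∈ H.neighborFinset u, H.degree i = ∑ i ∈ H.neighborFinset v, H.degree i := by
  have h := Finset.sum_card_bipartiteAbove_eq_sum_card_bipartiteBelow H.Adj
    (s := H.neighborFinset u) (t := H.neighborFinset v)
  have e1 : ∀ i ∈ H.neighborFinset u,
      (Finset.bipartiteAbove H.Adj (H.neighborFinset v) i).card = H.degree i := by
    intro i hi
    rw [H.mem_neighborFinset] at hi
    rw [← H.card_neighborFinset_eq_degree]
    congr 1
    ext w
    simp only [Finset.mem_bipartiteAbove, H.mem_neighborFinset]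
    refine ⟨fun h => h.2, fun h => ⟨?_, h⟩⟩
    by_contra hw
    exact htf u i w hi h ((hdom w).2 hw)
  have e2 : ∀ i ∈ H.neighborFinset v,
      (Finset.bipartiteBelow H.Adj (H.neighborFinset u) i).card = H.degree i := by
    intro i hi
    rw [H.mem_neighborFinset] at hi
    rw [← H.card_neighborFinset_eq_degree]
    congr 1
    ext w
    simp only [Finset.mem_bipartiteBelow, H.mem_neighborFinset]
    refine ⟨fun h => h.2.symm, fun h => ⟨?_, h.symm⟩⟩
    rw [hdom]
    exact htf v i w hi h
  rw [Finset.sum_congr rfl e1, Finset.sum_congr rfl e2] at h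
  exact h

lemma sum_sides {u v : V} (hdom : ∀ w, H.Adj u w ↔ ¬ H.Adj v w) (f : V → ℕ) :
    ∑ i, f i = ∑ i ∈ H.neighborFinset u, f i + ∑ i ∈ H.neighborFinset v, f i := by
  have : H.neighborFinset v = (H.neighborFinset u)ᶜ := by
    ext w; simp [hdom]
  rw [this, Finset.sum_add_sum_compl]

/-- There are `2m - 1` edges, counted from the side of `v`. Besides the `d(v) + d(i)` edges at `v`
and `i`, each other vertex of that side has the edge to `u`, and a further one whenever it is
adjacent to `j`; at most two neighbours of `j`, namely `v` and `i`, are missed. -/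
lemma degree_add_degree_le (hV : Fintype.card V = m + 2) {u v : V} (huv : H.Adj u v)
    (htf : ∀ u v w, H.Adj u v → H.Adj v w → ¬ H.Adj u w)
    (hdom : ∀ w, H.Adj u w ↔ ¬ H.Adj v w)
    (hside : ∑ i ∈ H.neighborFinset u, H.degree i + 1 = 2 * m)
    {i j : V} (hi : H.Adj u i) (hiv : i ≠ v) (hj : H.Adj v j) (hju : j ≠ u) :
    H.degree i + H.degree j ≤ m + 1 := by
  have hcard : H.degree u + H.degree v = m + 2 := by
    have := sum_sides hdom (fun _ => 1)
    simpa [hV] using this.symm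
  have hvP : v ∈ H.neighborFinset u := (H.mem_neighborFinset u v).2 huv
  have hiP : i ∈ (H.neighborFinset u).erase v :=
    Finset.mem_erase.2 ⟨hiv, (H.mem_neighborFinset u i).2 hi⟩
  rw [← Finset.add_sum_erase _ _ hvP, ← Finset.add_sum_erase _ _ hiP] at hside
  have h1 : ∀ w ∈ ((H.neighborFinset u).erase v).erase i,
      1 + (if H.Adj j w then 1 else 0) ≤ H.degree w := by
    intro w hw
    have hw' : H.Adj u w := by
      rw [← H.mem_neighborFinset]
      exact Finset.mem_of_mem_erase (Finset.mem_of_mem_erase hw)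
    split_ifs with h
    · rw [← H.card_neighborFinset_eq_degree]
      refine le_trans (le_of_eq ?_) (Finset.card_le_card (s := {u, j}) ?_)
      · rw [Finset.card_pair (Ne.symm hju)]
      · intro x hx
        simp only [Finset.mem_insert, Finset.mem_singleton] at hx
        rw [H.mem_neighborFinset]
        rcases hx with rfl | rfl
        · exact hw'.symm
        · exact h.symm
    · exact Nat.succ_le_of_lt ((H.degree_pos_iff_exists_adj w).2 ⟨u, hw'.symm⟩)
  have h2 := Finset.sum_le_sum h1
  have h3 : H.degree j ≤ (∑ w ∈ ((H.neighborFinset u).erase v).erase i,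
      if H.Adj j w then 1 else 0) + 2 := by
    rw [← Finset.card_filter, ← H.card_neighborFinset_eq_degree]
    have : H.neighborFinset j ⊆ insert v (insert i
        ((((H.neighborFinset u).erase v).erase i).filter (fun w => H.Adj j w))) := by
      intro w hw
      rw [H.mem_neighborFinset] at hw
      have : H.Adj u w := (hdom w).2 (htf v j w hj hw)
      simp only [Finset.mem_insert, Finset.mem_filter, Finset.mem_erase, H.mem_neighborFinset]
      tauto
    exact (Finset.card_le_card this).trans ((Finset.card_insert_le _ _).trans
      (Nat.succ_le_succ (Finset.card_insert_le _ _)))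
  rw [Finset.sum_add_distrib, Finset.sum_const, smul_eq_mul, mul_one,
    Finset.card_erase_of_mem hiP, Finset.card_erase_of_mem hvP,
    H.card_neighborFinset_eq_degree] at h2
  have h4 : 2 ≤ H.degree u := by
    rw [← H.card_neighborFinset_eq_degree]
    have := Finset.card_pos.2 ⟨i, hiP⟩
    rw [Finset.card_erase_of_mem hvP] at this
    omega
  omega

omit [DecidableEq V] in
-- Sum of `(d - 1)(k - d) ≥ 0`.
lemma sum_sq_le_of_le {s : Finset V} {k : ℕ} (hk : ∀ i ∈ s, 1 ≤ H.degree i ∧ H.degree i ≤ k) :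
    ∑ i ∈ s, H.degree i ^ 2 + k * s.card ≤ (k + 1) * ∑ i ∈ s, H.degree i := by
  rw [Finset.mul_sum, mul_comm k, ← smul_eq_mul (s.card), ← Finset.sum_const,
    ← Finset.sum_add_distrib]
  refine Finset.sum_le_sum fun i hi => ?_
  obtain ⟨h1, h2⟩ := hk i hi
  obtain ⟨a, ha⟩ := Nat.exists_eq_add_of_le h1
  obtain ⟨b, hb⟩ := Nat.exists_eq_add_of_le h2
  rw [hb, ha]
  nlinarith [Nat.zero_le (a * b)]

/-- Apart from `u` and `v`, the degrees are at most `k` on one side and `m + 1 - k` on the other, so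
convexity bounds `∑ d²` from above. With `d(u)² + d(v)² = (m + 2)² - 2 d(u) d(v)`, the lower bound
on `∑ d²` becomes an upper bound on the product. -/
lemma degree_mul_degree_le (hV : Fintype.card V = m + 2) {u v : V} (huv : H.Adj u v)
    (htf : ∀ u v w, H.Adj u v → H.Adj v w → ¬ H.Adj u w)
    (hdom : ∀ w, H.Adj u w ↔ ¬ H.Adj v w)
    (hsum : ∑ u, H.degree u + 2 = 4 * m) (hsq : 2 * m ^ 2 + m ≤ ∑ u, H.degree u ^ 2)
    (hu : 2 ≤ H.degree u) :
    2 * (H.degree u * H.degree v) + 2 ≤ 5 * m := by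
  have hcard : H.degree u + H.degree v = m + 2 := by
    have := sum_sides hdom (fun _ => 1)
    simpa [hV] using this.symm
  have hs1 := sum_sides hdom (fun i => H.degree i)
  have hs2 := sum_sides hdom (fun i => H.degree i ^ 2)
  have hs3 := sum_degree_side htf hdom
  have hvP : v ∈ H.neighborFinset u := (H.mem_neighborFinset u v).2 huv
  have huQ : u ∈ H.neighborFinset v := (H.mem_neighborFinset v u).2 huv.symm
  have hsideP : ∑ i ∈ H.neighborFinset u, H.degree i + 1 = 2 * m := by omega
  have hne : ((H.neighborFinset u).erase v).Nonempty := by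
    rw [← Finset.card_pos, Finset.card_erase_of_mem hvP, H.card_neighborFinset_eq_degree]
    omega
  obtain ⟨i₀, hi₀, hmax⟩ := Finset.exists_max_image _ (fun i => H.degree i) hne
  simp only [Finset.mem_erase, H.mem_neighborFinset] at hi₀ hmax
  have hbP := sum_sq_le_of_le (s := (H.neighborFinset u).erase v) (H := H) (k := H.degree i₀) (by
    intro i hi
    simp only [Finset.mem_erase, H.mem_neighborFinset] at hi
    exact ⟨Nat.succ_le_of_lt ((H.degree_pos_iff_exists_adj i).2 ⟨u, hi.2.symm⟩), hmax i hi⟩)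
  have hd : ∀ j, H.Adj v j → j ≠ u → H.degree i₀ + H.degree j ≤ m + 1 := fun j hj hju =>
    degree_add_degree_le hV huv htf hdom hsideP hi₀.2 hi₀.1 hj hju
  have hbQ := sum_sq_le_of_le (s := (H.neighborFinset v).erase u) (H := H)
    (k := m + 1 - H.degree i₀) (by
    intro j hj
    simp only [Finset.mem_erase, H.mem_neighborFinset] at hj
    refine ⟨Nat.succ_le_of_lt ((H.degree_pos_iff_exists_adj j).2 ⟨v, hj.2.symm⟩), ?_⟩
    have := hd j hj.2 hj.1
    omega)
  have hi₀le : H.degree i₀ ≤ m + 1 := by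
    have h1 : i₀ ∉ H.neighborFinset i₀ := by simp
    have h2 := Finset.card_lt_univ_of_notMem h1
    rw [H.card_neighborFinset_eq_degree, hV] at h2
    omega
  obtain ⟨k', hk'⟩ := Nat.exists_eq_add_of_le hi₀le
  have hk'' : m + 1 - H.degree i₀ = k' := by omega
  rw [hk''] at hbQ
  rw [Finset.card_erase_of_mem hvP, H.card_neighborFinset_eq_degree] at hbP
  rw [Finset.card_erase_of_mem huQ, H.card_neighborFinset_eq_degree] at hbQ
  have hv1 : 1 ≤ H.degree v := Nat.succ_le_of_lt ((H.degree_pos_iff_exists_adj v).2 ⟨u, huv.symm⟩)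
  have p1 := Finset.add_sum_erase (H.neighborFinset u) (fun i => H.degree i) hvP
  have p2 := Finset.add_sum_erase (H.neighborFinset u) (fun i => H.degree i ^ 2) hvP
  have q1 := Finset.add_sum_erase (H.neighborFinset v) (fun i => H.degree i) huQ
  have q2 := Finset.add_sum_erase (H.neighborFinset v) (fun i => H.degree i ^ 2) huQ
  set a := H.degree u
  set b := H.degree v
  set k := H.degree i₀
  generalize ∑ i ∈ (H.neighborFinset u).erase v, H.degree i = s1 at *
  generalize ∑ i ∈ (H.neighborFinset v).erase u, H.degree i = s2 at *
  generalize ∑ i ∈ (H.neighborFinset u).erase v, H.degree i ^ 2 = t1 at *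
  generalize ∑ i ∈ (H.neighborFinset v).erase u, H.degree i ^ 2 = t2 at *
  clear_value a b k
  have e1 : (s1 : ℤ) = 2 * m - 1 - b := by omega
  have e2 : (s2 : ℤ) = 2 * m - 1 - a := by omega
  have e3 : (b : ℤ) = m + 2 - a := by omega
  have e4 : (k' : ℤ) = m + 1 - k := by omega
  have f1 : (t1 : ℤ) + k * (a - 1) ≤ (k + 1) * s1 := by
    have : ((a - 1 : ℕ) : ℤ) = a - 1 := by omega
    rw [← this]; exact_mod_cast hbP
  have f2 : (t2 : ℤ) + k' * (b - 1) ≤ (k' + 1) * s2 := by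
    have : ((b - 1 : ℕ) : ℤ) = b - 1 := by omega
    rw [← this]; exact_mod_cast hbQ
  have f3 : 2 * (m : ℤ) ^ 2 + m ≤ b ^ 2 + t1 + (a ^ 2 + t2) := by
    have : 2 * m ^ 2 + m ≤ b ^ 2 + t1 + (a ^ 2 + t2) := by omega
    exact_mod_cast this
  -- The unknown `k` cancels, because `s1 - (a - 1) = s2 - (b - 1) = m - 2`.
  have f4 : 2 * ((a : ℤ) * b) + 2 ≤ 5 * m := by
    rw [e1, e3] at f1
    rw [e2, e3, e4] at f2
    rw [e3] at f3 ⊢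
    linarith
  exact_mod_cast f4

/-- The adjacency of a triangle-free graph on six vertices with a dominating edge `01`, where `0`
and `1` have degree `3`, in terms of the four remaining possible edges. -/
def doubleStar (b₁ b₂ b₃ b₄ : Bool) : Fin 6 → Fin 6 → Bool :=
  ![![false, true, true, true, false, false],
    ![true, false, false, false, true, true],
    ![true, false, false, false, b₁, b₂],
    ![true, false, false, false, b₃, b₄],
    ![false, true, b₁, b₃, false, false],
    ![false, true, b₂, b₄, false, false]]

/-- The degree sum leaves exactly two of the four optional edges. Two disjoint ones give `∑ d² =
34`, two sharing a vertex give 36, so they share a vertex, and each of the four choices is a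
relabelling of the same complement. -/
lemma doubleStar_cases : ∀ b₁ b₂ b₃ b₄ : Bool,
    ∑ i, ∑ j, (doubleStar b₁ b₂ b₃ b₄ i j).toNat = 14 →
    36 ≤ ∑ i, (∑ j, (doubleStar b₁ b₂ b₃ b₄ i j).toNat) ^ 2 →
    ∃ s : Fin 6 → Fin 6, Function.Bijective s ∧
      ∀ i j, (i ≠ j ∧ doubleStar b₁ b₂ b₃ b₄ (s i) (s j) = false) ↔ linkedTriangles i j = 1 := by
  have key : ∀ b₁ b₂ b₃ b₄ : Bool,
      ∑ i, ∑ j, (doubleStar b₁ b₂ b₃ b₄ i j).toNat = 14 →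
      36 ≤ ∑ i, (∑ j, (doubleStar b₁ b₂ b₃ b₄ i j).toNat) ^ 2 →
      (b₁, b₂, b₃, b₄) = (true, true, false, false) ∨
      (b₁, b₂, b₃, b₄) = (false, false, true, true) ∨
      (b₁, b₂, b₃, b₄) = (true, false, true, false) ∨
      (b₁, b₂, b₃, b₄) = (false, true, false, true) := by
    decide
  intro b₁ b₂ b₃ b₄ h1 h2
  rcases key b₁ b₂ b₃ b₄ h1 h2 with h | h | h | h <;> cases h
  · exact ⟨![1, 0, 4, 5, 2, 3], by decide, by decide⟩
  · exact ⟨![1, 0, 4, 5, 3, 2], by decide, by decide⟩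
  · exact ⟨![0, 1, 2, 3, 4, 5], by decide, by decide⟩
  · exact ⟨![0, 1, 2, 3, 5, 4], by decide, by decide⟩

lemma exists_linkedTriangles (hV : Fintype.card V = 6) {u v : V} (huv : H.Adj u v)
    (htf : ∀ u v w, H.Adj u v → H.Adj v w → ¬ H.Adj u w)
    (hdom : ∀ w, H.Adj u w ↔ ¬ H.Adj v w)
    (hsum : ∑ u, H.degree u = 14) (hsq : 36 ≤ ∑ u, H.degree u ^ 2)
    (hu : H.degree u = 3) (hv : H.degree v = 3) :
    ∃ e : Fin 6 ≃ V, ∀ i j, Hᶜ.Adj (e i) (e j) ↔ linkedTriangles i j = 1 := by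
  have hvP : v ∈ H.neighborFinset u := (H.mem_neighborFinset u v).2 huv
  have huQ : u ∈ H.neighborFinset v := (H.mem_neighborFinset v u).2 huv.symm
  obtain ⟨x₁, x₂, hx, hP⟩ := Finset.card_eq_two.1 (show ((H.neighborFinset u).erase v).card = 2 by
    rw [Finset.card_erase_of_mem hvP, H.card_neighborFinset_eq_degree, hu])
  obtain ⟨y₁, y₂, hy, hQ⟩ := Finset.card_eq_two.1 (show ((H.neighborFinset v).erase u).card = 2 by
    rw [Finset.card_erase_of_mem huQ, H.card_neighborFinset_eq_degree, hv])
  have hx₁ : x₁ ≠ v ∧ H.Adj u x₁ := by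
    have : x₁ ∈ (H.neighborFinset u).erase v := by simp [hP]
    simpa using this
  have hx₂ : x₂ ≠ v ∧ H.Adj u x₂ := by
    have : x₂ ∈ (H.neighborFinset u).erase v := by simp [hP]
    simpa using this
  have hy₁ : y₁ ≠ u ∧ H.Adj v y₁ := by
    have : y₁ ∈ (H.neighborFinset v).erase u := by simp [hQ]
    simpa using this
  have hy₂ : y₂ ≠ u ∧ H.Adj v y₂ := by
    have : y₂ ∈ (H.neighborFinset v).erase u := by simp [hQ]
    simpa using this
  have nx₁ := (hdom x₁).1 hx₁.2
  have nx₂ := (hdom x₂).1 hx₂.2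
  have ny₁ : ¬ H.Adj u y₁ := fun h => (hdom y₁).1 h hy₁.2
  have ny₂ : ¬ H.Adj u y₂ := fun h => (hdom y₂).1 h hy₂.2
  have nxx : ¬ H.Adj x₁ x₂ := htf x₁ u x₂ hx₁.2.symm hx₂.2
  have nyy : ¬ H.Adj y₁ y₂ := htf y₁ v y₂ hy₁.2.symm hy₂.2
  let t : Fin 6 → V := ![u, v, x₁, x₂, y₁, y₂]
  have hinj : Function.Injective t := by
    have h1 := huv.ne
    have h2 := hx₁.2.ne
    have h3 := hx₂.2.ne
    have h4 := hy₁.2.ne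
    have h5 := hy₂.2.ne
    have h6 : x₁ ≠ y₁ := fun h => nx₁ (h ▸ hy₁.2)
    have h7 : x₁ ≠ y₂ := fun h => nx₁ (h ▸ hy₂.2)
    have h8 : x₂ ≠ y₁ := fun h => nx₂ (h ▸ hy₁.2)
    have h9 : x₂ ≠ y₂ := fun h => nx₂ (h ▸ hy₂.2)
    have : (List.ofFn t).Nodup := by
      simp only [t, List.ofFn_succ, List.ofFn_zero, List.nodup_cons, List.mem_cons,
        List.not_mem_nil, or_false, not_or, List.nodup_nil, not_false_eq_true, and_true]
      exact ⟨⟨h1, h2, h3, Ne.symm hy₁.1, Ne.symm hy₂.1⟩, ⟨Ne.symm hx₁.1, Ne.symm hx₂.1, h4, h5⟩,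
        ⟨hx, h6, h7⟩, ⟨h8, h9⟩, hy⟩
    exact List.nodup_ofFn.1 this
  have hbij : Function.Bijective t :=
    (Fintype.bijective_iff_injective_and_card t).2 ⟨hinj, by simp [hV]⟩
  have hM : ∀ i j, H.Adj (t i) (t j) ↔ doubleStar (decide (H.Adj x₁ y₁)) (decide (H.Adj x₁ y₂))
      (decide (H.Adj x₂ y₁)) (decide (H.Adj x₂ y₂)) i j = true := by
    intro i j
    have c := H.adj_comm
    fin_cases i <;> fin_cases j <;> simp [t, doubleStar, huv, huv.symm, hx₁.2, hx₂.2, hy₁.2, hy₂.2,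
      hx₁.2.symm, hx₂.2.symm, hy₁.2.symm, hy₂.2.symm, nx₁, nx₂, ny₁, ny₂, nxx, nyy, c x₁ v, c x₂ v,
      c y₁ u, c y₂ u, c x₂ x₁, c y₂ y₁, c y₁ x₁, c y₁ x₂, c y₂ x₁, c y₂ x₂]
  have hdeg : ∀ i, H.degree (t i) = ∑ j, (doubleStar (decide (H.Adj x₁ y₁))
      (decide (H.Adj x₁ y₂)) (decide (H.Adj x₂ y₁)) (decide (H.Adj x₂ y₂)) i j).toNat := by
    intro i
    rw [← H.card_neighborFinset_eq_degree, SimpleGraph.neighborFinset_eq_filter,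
      Finset.card_filter, ← hbij.sum_comp]
    refine Finset.sum_congr rfl fun j _ => ?_
    by_cases h : H.Adj (t i) (t j)
    · rw [if_pos h, (hM i j).1 h]; rfl
    · rw [if_neg h, Bool.eq_false_iff.2 (fun h' => h ((hM i j).2 h'))]; rfl
  rw [← hbij.sum_comp] at hsum hsq
  simp only [hdeg] at hsum hsq
  obtain ⟨s, hs, h⟩ := doubleStar_cases _ _ _ _ hsum hsq
  refine ⟨Equiv.ofBijective _ (hbij.comp hs), fun i j => ?_⟩
  rw [← h i j, SimpleGraph.compl_adj]
  simp only [Equiv.ofBijective_apply, Function.comp_apply, hM, Bool.not_eq_true, ne_eq,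
    hinj.eq_iff, hs.1.eq_iff]

/-- Let `N(u) = {v, w}`. Then `v` misses only `w`, and the edge count gives `d(w) = m - 1`, so `w`
misses exactly one vertex `z` of the independent set `N(v)`. In the complement `N(v)` is the clique
and the pendant path is `z, w, v`. -/
lemma isKite_of_degree_eq_two (hV : Fintype.card V = m + 2) {u v : V} (huv : H.Adj u v)
    (htf : ∀ u v w, H.Adj u v → H.Adj v w → ¬ H.Adj u w)
    (hdom : ∀ w, H.Adj u w ↔ ¬ H.Adj v w)
    (hside : ∑ i ∈ H.neighborFinset u, H.degree i + 1 = 2 * m)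
    (hu : H.degree u = 2) : ∃ p q z, IsKite Hᶜ p q z := by
  have hcard : H.degree u + H.degree v = m + 2 := by
    have := sum_sides hdom (fun _ => 1)
    simpa [hV] using this.symm
  have hvP : v ∈ H.neighborFinset u := (H.mem_neighborFinset u v).2 huv
  obtain ⟨w, hw⟩ := Finset.card_eq_one.1 (show ((H.neighborFinset u).erase v).card = 1 by
    rw [Finset.card_erase_of_mem hvP, H.card_neighborFinset_eq_degree, hu])
  rw [← Finset.add_sum_erase _ _ hvP, hw, Finset.sum_singleton] at hside
  have hwu : w ≠ v ∧ H.Adj u w := by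
    have : w ∈ (H.neighborFinset u).erase v := by simp [hw]
    simpa using this
  have hP : ∀ x, H.Adj u x ↔ x = v ∨ x = w := by
    intro x
    by_cases hx : x = v
    · simp [hx, huv]
    · have : x ∈ (H.neighborFinset u).erase v ↔ x = w := by rw [hw]; simp
      simpa [hx] using this
  have hQ : ∀ x, H.Adj v x ↔ x ≠ v ∧ x ≠ w := by
    intro x
    have := hP x
    rw [hdom] at this
    tauto
  have hsub : H.neighborFinset w ⊆ H.neighborFinset v := by
    intro x hx
    rw [H.mem_neighborFinset] at hx ⊢
    by_contra h
    exact htf u w x hwu.2 hx ((hdom x).2 h)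
  obtain ⟨z, hz⟩ := Finset.card_eq_one.1
    (show (H.neighborFinset v \ H.neighborFinset w).card = 1 by
      rw [Finset.card_sdiff_of_subset hsub, H.card_neighborFinset_eq_degree,
        H.card_neighborFinset_eq_degree]
      omega)
  have hz' : ∀ x, H.Adj v x ∧ ¬ H.Adj w x ↔ x = z := by
    intro x
    have : x ∈ H.neighborFinset v \ H.neighborFinset w ↔ x = z := by rw [hz]; simp
    simpa using this
  have hzv := (hz' z).2 rfl
  have hz1 := (hQ z).1 hzv.1
  refine ⟨v, w, z, ⟨hwu.1.symm, hz1.1, hz1.2, fun x => ?_, fun x => ?_, ?_⟩⟩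
  · rw [SimpleGraph.compl_adj, hQ]
    have := hwu.1
    grind
  · have h1 := hz' x
    have h2 := hQ x
    have h3 : ¬ H.Adj w v := fun h => ((hQ w).1 h.symm).2 rfl
    rw [SimpleGraph.compl_adj]
    by_cases hx : x = v
    · subst hx; simp [hwu.1, h3]
    · by_cases hxw : x = w
      · subst hxw; simp [hx, Ne.symm hz1.2]
      · simp only [hx, false_or, ← h1, h2]
        simp [hx, hxw, Ne.symm hxw]
  · intro x y hxp hxq hyp hyq hxy
    rw [SimpleGraph.compl_adj]
    exact ⟨hxy, htf x v y ((hQ x).2 ⟨hxp, hxq⟩).symm ((hQ y).2 ⟨hyp, hyq⟩)⟩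

lemma isKite_of_card_eq_three (hV : Fintype.card V = 3) (hsum : ∑ u, H.degree u = 2) :
    ∃ p q z, IsKite Hᶜ p q z := by
  obtain ⟨u, -, hu⟩ := Finset.exists_ne_zero_of_sum_ne_zero (by rw [hsum]; norm_num :
    ∑ u, H.degree u ≠ 0)
  obtain ⟨v, huv⟩ := (H.degree_pos_iff_exists_adj u).1 (Nat.pos_of_ne_zero hu)
  have hv : H.degree v ≠ 0 := ((H.degree_pos_iff_exists_adj v).2 ⟨u, huv.symm⟩).ne'
  have hne := huv.ne
  obtain ⟨w, hw⟩ := Finset.card_eq_one.1 (show (((Finset.univ : Finset V).erase u).erase v).card = 1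
    by rw [Finset.card_erase_of_mem (by simp [hne.symm]), Finset.card_erase_of_mem (by simp),
      Finset.card_univ, hV])
  have hw' : ∀ x, x = u ∨ x = v ∨ x = w := by
    intro x
    have : x ∈ ((Finset.univ : Finset V).erase u).erase v ↔ x = w := by rw [hw]; simp
    simp only [Finset.mem_erase, Finset.mem_univ, and_true] at this
    tauto
  have hwu : w ≠ v ∧ w ≠ u := by
    have : w ∈ ((Finset.univ : Finset V).erase u).erase v := by simp [hw]
    simpa using this
  rw [← Finset.add_sum_erase _ _ (Finset.mem_univ u), ← Finset.add_sum_erase _ _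
    (show v ∈ Finset.univ.erase u by simp [hne.symm]), hw, Finset.sum_singleton] at hsum
  have hw0 : H.degree w = 0 := by omega
  have hwn : ∀ x, ¬ H.Adj w x := by
    intro x hx
    exact ((H.degree_pos_iff_exists_adj w).2 ⟨x, hx⟩).ne' hw0
  have hwn' : ∀ x, ¬ H.Adj x w := fun x hx => hwn x hx.symm
  refine ⟨u, w, v, ⟨hwu.2.symm, hne.symm, hwu.1.symm, fun x => ?_, fun x => ?_, ?_⟩⟩
  · rw [SimpleGraph.compl_adj]
    rcases hw' x with rfl | rfl | rfl
    · simp [hwu.2.symm]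
    · simp [huv, hwu.1.symm]
    · simp [hwu.2.symm, hwn']
  · rw [SimpleGraph.compl_adj]
    rcases hw' x with rfl | rfl | rfl
    · simp [hwu.2, hwn]
    · simp [hwu.1, hwn]
    · simp [hwu.1, hwu.2]
  · intro x y hxp hxq hyp hyq hxy
    rcases hw' x with h | h | h <;> rcases hw' y with h' | h' | h' <;> grind

/-- The complements of triangle-free graphs with as many edges and at least as many triangles as
the oriented kites. -/
theorem isKite_or_exceptional (hm : 1 ≤ m) (hV : Fintype.card V = m + 2)
    (htf : ∀ u v w, H.Adj u v → H.Adj v w → ¬ H.Adj u w)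
    (hsum : ∑ u, H.degree u + 2 = 4 * m)
    (hsq : 2 ≤ m → 2 * m ^ 2 + m ≤ ∑ u, H.degree u ^ 2) :
    (∃ p q z, IsKite Hᶜ p q z) ∨ (m = 2 ∧ ∃ v, ∀ w, w ≠ v → H.Adj v w) ∨
      (m = 4 ∧ ∃ e : Fin 6 ≃ V, ∀ i j, Hᶜ.Adj (e i) (e j) ↔ linkedTriangles i j = 1) := by
  -- For `m = 1` there is no bound on the degree squares, but `H` is a single edge on three
  -- vertices.
  rcases Nat.eq_or_lt_of_le hm with rfl | hm2
  · exact Or.inl (isKite_of_card_eq_three hV (by omega))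
  have hsq := hsq hm2
  obtain ⟨u, v, huv, hdom⟩ := exists_dominating_edge hV htf hsum hsq
  have hdom' : ∀ w, H.Adj v w ↔ ¬ H.Adj u w := fun w => by rw [hdom]; tauto
  have hs1 := sum_sides hdom (fun i => H.degree i)
  have hs2 := sum_degree_side htf hdom
  have hcard : H.degree u + H.degree v = m + 2 := by
    have := sum_sides hdom (fun _ => 1)
    simpa [hV] using this.symm
  have hu1 : H.degree u ≠ 0 := ((H.degree_pos_iff_exists_adj u).2 ⟨v, huv⟩).ne'
  have hv1 : H.degree v ≠ 0 := ((H.degree_pos_iff_exists_adj v).2 ⟨u, huv.symm⟩).ne'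
  -- If `d(u) = 1`, then all `2m - 1` edges are at `v`, whose degree is `m + 1`; so `m = 2` and `H`
  -- is a star.
  have hstar : ∀ u v, H.Adj u v → (∀ w, H.Adj u w ↔ ¬ H.Adj v w) →
      ∑ i ∈ H.neighborFinset u, H.degree i + 1 = 2 * m → H.degree u + H.degree v = m + 2 →
      H.degree u = 1 → m = 2 ∧ ∃ v, ∀ w, w ≠ v → H.Adj v w := by
    intro u v huv hdom hs hc hu
    obtain ⟨x, hx⟩ := Finset.card_eq_one.1 ((H.card_neighborFinset_eq_degree u).trans hu)
    have hv : v = x := by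
      have : v ∈ H.neighborFinset u := (H.mem_neighborFinset u v).2 huv
      simpa [hx] using this
    subst hv
    rw [hx, Finset.sum_singleton] at hs
    refine ⟨by omega, v, fun w hw => ?_⟩
    by_contra h
    have h1 := (H.mem_neighborFinset u w).2 ((hdom w).2 h)
    rw [hx] at h1
    simp [hw] at h1
  by_cases hu : H.degree u = 1
  · exact Or.inr (Or.inl (hstar u v huv hdom (by omega) hcard hu))
  by_cases hv : H.degree v = 1
  · exact Or.inr (Or.inl (hstar v u huv.symm hdom' (by omega) (by omega) hv))
  by_cases hu2 : H.degree u = 2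
  · exact Or.inl (isKite_of_degree_eq_two hV huv htf hdom (by omega) hu2)
  by_cases hv2 : H.degree v = 2
  · exact Or.inl (isKite_of_degree_eq_two hV huv.symm htf hdom' (by omega) hv2)
  have hle := degree_mul_degree_le hV huv htf hdom hsum hsq (by omega)
  obtain ⟨a, ha⟩ : ∃ a, H.degree u = a + 3 := ⟨H.degree u - 3, by omega⟩
  obtain ⟨b, hb⟩ : ∃ b, H.degree v = b + 3 := ⟨H.degree v - 3, by omega⟩
  have hm' : m = a + b + 4 := by omega
  rw [ha, hb, hm'] at hle
  -- After subtracting 3 from both degrees the product bound reads `2ab + a + b ≤ 0`.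
  have hab : a + b = 0 := by nlinarith [Nat.zero_le (a * b)]
  have hm4 : m = 4 := by omega
  subst hm4
  exact Or.inr (Or.inr ⟨rfl, exists_linkedTriangles hV huv htf hdom (by omega) (by omega)
    (by omega) (by omega)⟩)

end Graph

/-! ### Eisenstein matrices: traces and closed walks. -/

section Eisenstein

variable {V : Type*} (Φ : SignedDigraph V)

lemma eisenstein_of_not_adj {u v : V} (h : ¬ Φ.graph.Adj u v) : Φ.eisenstein u v = 0 := by
  simp [eisenstein, h]

lemma eisenstein_pow_six {u v : V} (h : Φ.graph.Adj u v) : Φ.eisenstein u v ^ 6 = 1 := by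
  have h1 := (Φ.gain ⟨(u, v), h⟩).2
  rw [mem_rootsOfUnity] at h1
  have h2 := congrArg Units.val h1
  simpa [eisenstein, h] using h2

lemma eisenstein_swap (u v : V) : Φ.eisenstein v u = (Φ.eisenstein u v)⁻¹ := by
  by_cases h : Φ.graph.Adj u v
  · have h1 := Φ.gain_symm ⟨(u, v), h⟩
    have h2 : Φ.graph.Adj v u := h.symm
    simp only [eisenstein, Matrix.of_apply, dif_pos h, dif_pos h2]
    change ((Φ.gain (SimpleGraph.Dart.symm ⟨(u, v), h⟩) : ℂˣ) : ℂ) = _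
    rw [h1]
    simp
  · rw [Φ.eisenstein_of_not_adj h, Φ.eisenstein_of_not_adj (fun h' => h h'.symm),
      _root_.inv_zero]

lemma eisenstein_self (u : V) : Φ.eisenstein u u = 0 :=
  Φ.eisenstein_of_not_adj (Φ.graph.irrefl)

lemma eisenstein_ne_zero {u v : V} (h : Φ.graph.Adj u v) : Φ.eisenstein u v ≠ 0 := by
  intro h0
  have := Φ.eisenstein_pow_six h
  simp [h0] at this

lemma eisenstein_isHermitian : Φ.eisenstein.IsHermitian := by
  ext u v
  rw [Matrix.conjTranspose_apply]
  by_cases h : Φ.graph.Adj v u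
  · rw [star_eq_inv_of_pow_six (Φ.eisenstein_pow_six h), Φ.eisenstein_swap v u]
  · rw [Φ.eisenstein_of_not_adj h, Φ.eisenstein_of_not_adj (fun h' => h h'.symm), star_zero]

lemma eisenstein_converse (u v : V) : Φ.converse.eisenstein u v = Φ.eisenstein v u := by
  by_cases h : Φ.graph.Adj u v
  · have h' : Φ.converse.graph.Adj u v := h
    simp only [eisenstein, Matrix.of_apply, dif_pos h', dif_pos h.symm]
    rfl
  · rw [Φ.eisenstein_of_not_adj (fun h' => h h'.symm), eisenstein_of_not_adj]
    exact h

lemma isCliqueGain_restrict (P : V → Prop)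
    (hP : ∀ u v, P u → P v → u ≠ v → Φ.graph.Adj u v) :
    IsCliqueGain (fun u v : {x // P x} => Φ.eisenstein u v) where
  diag i := Φ.eisenstein_self i
  pow_six i j h := Φ.eisenstein_pow_six (hP i j i.2 j.2 fun h' => h (Subtype.ext h'))
  inv i j _ := Φ.eisenstein_swap i j

variable [Fintype V] [DecidableEq V]

lemma trace_eisenstein_sq [DecidableRel Φ.graph.Adj] :
    (Φ.eisenstein ^ 2).trace = ∑ u, ∑ v, if Φ.graph.Adj u v then 1 else 0 := by
  rw [pow_two]
  simp only [Matrix.trace, Matrix.diag_apply, Matrix.mul_apply]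
  refine Finset.sum_congr rfl fun u _ => Finset.sum_congr rfl fun v _ => ?_
  split_ifs with h
  · rw [Φ.eisenstein_swap u v, mul_inv_cancel₀ (Φ.eisenstein_ne_zero h)]
  · rw [Φ.eisenstein_of_not_adj h, zero_mul]

/-- Entries of the power sum gains of norm 1 over the walks that the adjacency matrix counts. -/
lemma norm_eisenstein_pow_le [DecidableRel Φ.graph.Adj] (k : ℕ) (u v : V) :
    ‖(Φ.eisenstein ^ k) u v‖ ≤ (Φ.graph.adjMatrix ℝ ^ k) u v := by
  induction k generalizing u v with
  | zero => simp only [pow_zero, Matrix.one_apply]; split_ifs <;> simp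
  | succ k ih =>
    rw [pow_succ, pow_succ, Matrix.mul_apply, Matrix.mul_apply]
    refine (norm_sum_le _ _).trans (Finset.sum_le_sum fun w _ => ?_)
    rw [norm_mul]
    have h1 : ‖Φ.eisenstein w v‖ ≤ Φ.graph.adjMatrix ℝ w v := by
      rw [SimpleGraph.adjMatrix_apply]
      split_ifs with h
      · exact (Complex.norm_eq_one_of_pow_eq_one (Φ.eisenstein_pow_six h) (by norm_num)).le
      · rw [Φ.eisenstein_of_not_adj h, norm_zero]
    exact mul_le_mul (ih u w) h1 (norm_nonneg _) ((norm_nonneg _).trans (ih u w))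

lemma re_trace_eisenstein_pow_le [DecidableRel Φ.graph.Adj] (k : ℕ) :
    (Φ.eisenstein ^ k).trace.re ≤ (Φ.graph.adjMatrix ℝ ^ k).trace := by
  refine (Complex.re_le_norm _).trans ((norm_sum_le _ _).trans (Finset.sum_le_sum fun u _ => ?_))
  exact Φ.norm_eisenstein_pow_le k u u

omit [DecidableEq V] in
lemma sum_eq_sum_subtype (P : V → Prop) [Fintype {x // P x}] (f : V → ℂ)
    (h : ∀ x, ¬ P x → f x = 0) : ∑ x, f x = ∑ x : {x // P x}, f x := by
  classical
  rw [← Finset.sum_subtype (Finset.univ.filter P) (by simp) f, Finset.sum_filter]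
  refine Finset.sum_congr rfl fun x _ => ?_
  split_ifs with hx
  · rfl
  · exact h x hx

/-- Vertices on no triangle do not contribute to the trace of the cube. -/
lemma trace_pow_three_eq_restrict (P : V → Prop) [Fintype {x // P x}] [DecidableEq {x // P x}]
    (hP : ∀ u v w, ¬ P u → Φ.graph.Adj u v → Φ.graph.Adj v w → ¬ Φ.graph.Adj w u) :
    (Φ.eisenstein ^ 3).trace =
      (Matrix.of (fun u v : {x // P x} => Φ.eisenstein u v) ^ 3).trace := by
  have key : ∀ u v w, ¬ P u → Φ.eisenstein u v * Φ.eisenstein v w * Φ.eisenstein w u = 0 := by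
    intro u v w hu
    by_cases h1 : Φ.graph.Adj u v
    · by_cases h2 : Φ.graph.Adj v w
      · rw [Φ.eisenstein_of_not_adj (hP u v w hu h1 h2), mul_zero]
      · rw [Φ.eisenstein_of_not_adj h2]; ring
    · rw [Φ.eisenstein_of_not_adj h1]; ring
  rw [trace_pow_three, trace_pow_three, sum_eq_sum_subtype P]
  · refine Finset.sum_congr rfl fun u _ => ?_
    rw [sum_eq_sum_subtype P]
    · refine Finset.sum_congr rfl fun v _ => ?_
      rw [sum_eq_sum_subtype P]
      · rfl
      · intro w hw
        rw [← key w u v hw]; ring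
    · intro v hv
      refine Finset.sum_eq_zero fun w _ => ?_
      rw [← key v w u hv]; ring
  · intro u hu
    exact Finset.sum_eq_zero fun v _ => Finset.sum_eq_zero fun w _ => key u v w hu

variable {Φ}

/-- A lower bound for the degree squares of the complement in terms of the triangles. -/
lemma sum_degree_sq_ge {H : SimpleGraph V} [DecidableRel H.Adj] [DecidableRel Φ.graph.Adj]
    (hH : H = Φ.graphᶜ) {m : ℕ} (hV : Fintype.card V = m + 2)
    (htf : ∀ u v w, H.Adj u v → H.Adj v w → ¬ H.Adj u w)
    (hsum : ∑ u, H.degree u + 2 = 4 * m)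
    (hT : (m : ℝ) * (m - 1) * (m - 2) - 3 * (m - 2) ≤ (Φ.eisenstein ^ 3).trace.re) :
    2 * m ^ 2 + m ≤ ∑ u, H.degree u ^ 2 := by
  have h1 := hT.trans (Φ.re_trace_eisenstein_pow_le 3)
  -- Expanding around the complete graph turns the triangle count into `∑ d` and `∑ d²` of `H`; the
  -- cubic term vanishes because `H` is triangle-free.
  have hA : Φ.graph.adjMatrix ℝ = Matrix.of (fun _ _ => (1 : ℝ)) - 1 + -(H.adjMatrix ℝ) := by
    ext u v
    simp only [SimpleGraph.adjMatrix_apply, Matrix.add_apply, Matrix.sub_apply, Matrix.of_apply,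
      Matrix.neg_apply, Matrix.one_apply, hH, SimpleGraph.compl_adj]
    by_cases huv : u = v
    · subst huv; simp
    · by_cases h : Φ.graph.Adj u v <;> simp [huv, h]
  have e1 : ∑ i, ∑ j, (-(H.adjMatrix ℝ)) i j = -∑ u, (H.degree u : ℝ) := by
    simp only [Matrix.neg_apply, Finset.sum_neg_distrib]
    congr 1
    refine Finset.sum_congr rfl fun u _ => ?_
    simp only [SimpleGraph.adjMatrix_apply, Finset.sum_boole]
    rw [← H.card_neighborFinset_eq_degree, SimpleGraph.neighborFinset_eq_filter]
  have e2 : (-(H.adjMatrix ℝ)).trace = 0 := by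
    simp [Matrix.trace_neg]
  have e3 : ∑ i, ∑ j, (-(H.adjMatrix ℝ) * -(H.adjMatrix ℝ)) i j = ∑ u, (H.degree u : ℝ) ^ 2 := by
    rw [neg_mul_neg]
    simp only [SimpleGraph.adjMatrix_mul_apply]
    have : ∀ i, ∑ j, ∑ u ∈ H.neighborFinset i, H.adjMatrix ℝ u j =
        ∑ u ∈ H.neighborFinset i, (H.degree u : ℝ) := by
      intro i
      rw [Finset.sum_comm]
      refine Finset.sum_congr rfl fun u _ => ?_
      simp only [SimpleGraph.adjMatrix_apply, Finset.sum_boole]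
      rw [← H.card_neighborFinset_eq_degree, SimpleGraph.neighborFinset_eq_filter]
    simp only [this]
    exact_mod_cast sum_neighbor_degree H
  have e4 : (-(H.adjMatrix ℝ) * -(H.adjMatrix ℝ)).trace = ∑ u, (H.degree u : ℝ) := by
    rw [neg_mul_neg]
    simp only [Matrix.trace, Matrix.diag_apply, SimpleGraph.adjMatrix_mul_self_apply_self]
  have e5 : (-(H.adjMatrix ℝ) * -(H.adjMatrix ℝ) * -(H.adjMatrix ℝ)).trace = 0 := by
    have : (-(H.adjMatrix ℝ) * -(H.adjMatrix ℝ) * -(H.adjMatrix ℝ)) = (-(H.adjMatrix ℝ)) ^ 3 := by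
      rw [pow_succ, pow_two]
    rw [this, trace_pow_three]
    refine Finset.sum_eq_zero fun u _ => Finset.sum_eq_zero fun v _ => Finset.sum_eq_zero
      fun w _ => ?_
    simp only [Matrix.neg_apply, SimpleGraph.adjMatrix_apply]
    by_cases c1 : H.Adj u v
    · by_cases c2 : H.Adj v w
      · have c3 : ¬ H.Adj w u := fun h => htf u v w c1 c2 h.symm
        simp [c3]
      · simp [c2]
    · simp [c1]
  rw [hA, trace_complete_add_pow_three, e1, e2, e3, e4, e5, hV] at h1
  have h2 : ∑ u, (H.degree u : ℝ) = 4 * m - 2 := by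
    have : (∑ u, (H.degree u : ℝ)) + 2 = 4 * m := by exact_mod_cast hsum
    linarith
  rw [h2] at h1
  push_cast at h1
  have h3 : (2 * m ^ 2 + m : ℝ) ≤ ∑ u, (H.degree u : ℝ) ^ 2 := by nlinarith
  exact_mod_cast h3

end Eisenstein

/-! ### Kite graphs. -/

section Kite

variable {V W : Type*}

lemma IsKite.map {G : SimpleGraph V} {G' : SimpleGraph W} {p q z : V} (h : IsKite G p q z)
    (f : G ≃g G') : IsKite G' (f p) (f q) (f z) where
  p_ne_q := f.injective.ne h.p_ne_q
  z_ne_p := f.injective.ne h.z_ne_p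
  z_ne_q := f.injective.ne h.z_ne_q
  adj_p w := by
    obtain ⟨w, rfl⟩ := f.surjective w
    rw [f.map_adj_iff, h.adj_p, f.injective.eq_iff]
  adj_q w := by
    obtain ⟨w, rfl⟩ := f.surjective w
    rw [f.map_adj_iff, h.adj_q, f.injective.eq_iff, f.injective.eq_iff]
  clique u v := by
    obtain ⟨u, rfl⟩ := f.surjective u
    obtain ⟨v, rfl⟩ := f.surjective v
    rw [f.map_adj_iff, f.injective.ne_iff, f.injective.ne_iff, f.injective.ne_iff,
      f.injective.ne_iff, f.injective.ne_iff]
    exact h.clique u v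

lemma isKite_kiteGraph {m : ℕ} (hm : 1 ≤ m) :
    IsKite (kiteGraph m 2) (Sum.inr 1) (Sum.inr 0) (Sum.inl ⟨0, hm⟩) where
  p_ne_q := by simp
  z_ne_p := by simp
  z_ne_q := by simp
  adj_p w := by
    rcases w with i | j
    · simp [kiteGraph]
    · fin_cases j <;> simp [kiteGraph, SimpleGraph.pathGraph_adj]
  adj_q w := by
    rcases w with i | j
    · rw [kiteGraph, SimpleGraph.sup_adj, SimpleGraph.fromRel_adj]
      simp only [SimpleGraph.sum_adj, reduceCtorEq, false_or, ne_eq, not_false_eq_true, true_and,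
        Sum.inl.injEq, Sum.inr.injEq]
      constructor
      · rintro (⟨i', j', -, -, h, -⟩ | ⟨i', j', h1, -, rfl, -⟩)
        · exact absurd h (by simp)
        · exact Fin.ext h1
      · rintro rfl
        exact Or.inr ⟨_, 0, rfl, rfl, rfl, rfl⟩
    · fin_cases j <;> simp [kiteGraph, SimpleGraph.pathGraph_adj]
  clique u v := by
    rcases u with i | j
    · rcases v with i' | j'
      · intro _ _ _ _ h
        simpa [kiteGraph] using h
      · fin_cases j' <;> simp
    · fin_cases j <;> simp

lemma IsKite.not_triangle {G : SimpleGraph V} {p q z : V} (h : IsKite G p q z) {u v w : V}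
    (hu : ¬ (u ≠ p ∧ u ≠ q)) (h1 : G.Adj u v) (h2 : G.Adj v w) : ¬ G.Adj w u := by
  intro h3
  have hpz : ¬ G.Adj p z := by rw [h.adj_p]; exact h.z_ne_q
  have hp : ¬ G.Adj p p := G.irrefl
  have hz : ¬ G.Adj z z := G.irrefl
  by_cases hup : u = p
  · subst hup
    have e1 := (h.adj_p v).1 h1
    have e2 := (h.adj_p w).1 h3.symm
    rw [e1, e2] at h2
    exact G.irrefl h2
  · have huq : u = q := by tauto
    subst huq
    rcases (h.adj_q v).1 h1 with rfl | rfl <;> rcases (h.adj_q w).1 h3.symm with rfl | rfl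
    · exact hp h2
    · exact hpz h2
    · exact hpz h2.symm
    · exact hz h2

variable [Fintype V] [DecidableEq V]

lemma sum_cliqueInd {p q : V} (hpq : p ≠ q) :
    ∑ u, cliqueInd p q u = (Fintype.card V : ℂ) - 2 := by
  have : ∀ u : V, cliqueInd p q u = 1 - (if u = p then 1 else 0) - (if u = q then 1 else 0) := by
    intro u
    unfold cliqueInd
    by_cases h : u = p
    · subst h; simp [hpq]
    · by_cases h' : u = q
      · subst h'; simp [hpq.symm]
      · simp [h, h']
  simp only [this, Finset.sum_sub_distrib, Finset.sum_ite_eq', Finset.mem_univ, if_true]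
  simp
  ring

omit [Fintype V] in
-- With gain 1 the terms of the distinguished edge vanish, so its placement `z, z` is only a dummy.
lemma IsKite.adj_eq_kiteMatrix {G : SimpleGraph V} [DecidableRel G.Adj] {p q z : V}
    (h : IsKite G p q z) (u v : V) :
    (if G.Adj u v then 1 else 0 : ℂ) = kiteMatrix p q z z z 1 u v := by
  have h1 := h.p_ne_q
  have h2 := h.z_ne_p
  have h3 := h.z_ne_q
  have hp := h.adj_p
  have hq := h.adj_q
  have hp' : ∀ w, G.Adj w p ↔ w = q := fun w => by rw [G.adj_comm, hp]
  have hq' : ∀ w, G.Adj w q ↔ w = p ∨ w = z := fun w => by rw [G.adj_comm, hq]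
  by_cases up : u = p
  · subst up
    simp [hp, kiteMatrix, cliqueInd, h1, Ne.symm h2]
  by_cases uq : u = q
  · subst uq
    by_cases vz : v = z
    · subst vz; simp [hq, kiteMatrix, cliqueInd, Ne.symm h1, Ne.symm h3, h2]
    · simp [hq, kiteMatrix, cliqueInd, Ne.symm h1, Ne.symm h3, vz]
  by_cases vp : v = p
  · subst vp
    simp [hp', kiteMatrix, cliqueInd, h1, Ne.symm h2, up, uq]
  by_cases vq : v = q
  · subst vq
    simp [hq', kiteMatrix, cliqueInd, Ne.symm h1, Ne.symm h3, up, uq]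
  by_cases uv : u = v
  · subst uv
    simp [kiteMatrix, cliqueInd, up, uq]
  · simp [h.clique u v up uq vp vq uv, kiteMatrix, cliqueInd, up, uq, vp, vq, uv]

lemma IsKite.sum_adj {G : SimpleGraph V} [DecidableRel G.Adj] {p q z : V}
    (h : IsKite G p q z) {m : ℕ} (hV : Fintype.card V = m + 2) :
    ∑ u, ∑ v, (if G.Adj u v then 1 else 0 : ℂ) = m * (m - 1) + 4 := by
  simp only [h.adj_eq_kiteMatrix, kiteMatrix, sub_self, zero_mul, add_zero, inv_one,
    Finset.sum_add_distrib, Finset.sum_sub_distrib, ← Finset.mul_sum, Finset.sum_ite_eq,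
    Finset.sum_ite_eq', Finset.mem_univ, if_true, ← Finset.sum_mul, mul_one, sum_cliqueInd h.p_ne_q,
    hV]
  push_cast
  ring

end Kite

/-! ### Normal forms of the gains on a kite. -/

section NormalForm

variable {V W : Type*} [Fintype V] [DecidableEq V] [Fintype W] [DecidableEq W]

/-- Up to the switch `x`, the Eisenstein matrix of `Φ` is a kite matrix. -/
structure IsKiteForm (Φ : SignedDigraph V) (p q z a b : V) (g : ℂ) (x : V → ℂ) : Prop where
  isKite : IsKite Φ.graph p q z
  a_ne_p : a ≠ p
  a_ne_q : a ≠ q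
  b_ne_p : b ≠ p
  b_ne_q : b ≠ q
  edgeGain : EdgeGain a b g
  pow_six : ∀ u, x u ^ 6 = 1
  eq : ∀ u v, Φ.eisenstein u v = x u * kiteMatrix p q z a b g u v * (x v)⁻¹

omit [Fintype V] in
lemma IsKite.exists_isKiteForm {Φ : SignedDigraph V} {p q z : V} (h : IsKite Φ.graph p q z)
    (a b : {u // u ≠ p ∧ u ≠ q}) {g : ℂ} (hg : EdgeGain a.1 b.1 g) (x : {u // u ≠ p ∧ u ≠ q} → ℂ)
    (hx : ∀ u, x u ^ 6 = 1) (hE : ∀ u v : {u // u ≠ p ∧ u ≠ q}, u ≠ v → Φ.eisenstein u v =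
      x u * (if u = a ∧ v = b then g else if u = b ∧ v = a then g⁻¹ else 1) * (x v)⁻¹) :
    ∃ y, IsKiteForm Φ p q z a b g y := by
  have h1 := h.p_ne_q
  have h2 := h.z_ne_p
  have h3 := h.z_ne_q
  have hp := h.adj_p
  have hq := h.adj_q
  let z' : {u // u ≠ p ∧ u ≠ q} := ⟨z, h2, h3⟩
  -- The pendant path closes no cycle, so the clique switch extends along `z, q, p` by multiplying
  -- up the gains.
  let y : V → ℂ := fun u => if hu : u ≠ p ∧ u ≠ q then x ⟨u, hu⟩ else
    if u = q then Φ.eisenstein q z * x z' else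
      Φ.eisenstein p q * (Φ.eisenstein q z * x z')
  have hqz : Φ.graph.Adj q z := (hq z).2 (Or.inr rfl)
  have hpq : Φ.graph.Adj p q := (hp q).2 rfl
  have yq : y q = Φ.eisenstein q z * x z' := by simp [y]
  have yp : y p = Φ.eisenstein p q * y q := by rw [yq]; simp [y, h1]
  have yc : ∀ u : {u // u ≠ p ∧ u ≠ q}, y u = x u := by
    intro u
    simp only [y]
    rw [dif_pos u.2]
  have y6 : ∀ u, y u ^ 6 = 1 := by
    have hyq : y q ^ 6 = 1 := by rw [yq, mul_pow, Φ.eisenstein_pow_six hqz, hx, one_mul]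
    intro u
    by_cases hu : u ≠ p ∧ u ≠ q
    · rw [yc ⟨u, hu⟩, hx]
    · by_cases hu' : u = p
      · rw [hu', yp, mul_pow, Φ.eisenstein_pow_six hpq, hyq, one_mul]
      · have : u = q := by tauto
        rw [this, hyq]
  have y0 : ∀ u, y u ≠ 0 := by
    intro u h0
    have := y6 u
    simp [h0] at this
  have eqz : Φ.eisenstein q z = y q * (y z)⁻¹ := by
    rw [yq, show y z = x z' from yc z']
    have : x z' ≠ 0 := by rw [← yc z']; exact y0 _
    field_simp
  have ezq : Φ.eisenstein z q = y z * (y q)⁻¹ := by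
    rw [Φ.eisenstein_swap q z, eqz, mul_inv, inv_inv, mul_comm]
  have epq : Φ.eisenstein p q = y p * (y q)⁻¹ := by
    rw [yp, mul_assoc, mul_inv_cancel₀ (y0 q), mul_one]
  have eqp : Φ.eisenstein q p = y q * (y p)⁻¹ := by
    rw [Φ.eisenstein_swap p q, epq, mul_inv, inv_inv, mul_comm]
  have hp' : ∀ w, Φ.graph.Adj w p ↔ w = q := fun w => by rw [Φ.graph.adj_comm, hp]
  have hq' : ∀ w, Φ.graph.Adj w q ↔ w = p ∨ w = z := fun w => by rw [Φ.graph.adj_comm, hq]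
  have a1 := a.2.1
  have a2 := a.2.2
  have b1 := b.2.1
  have b2 := b.2.2
  refine ⟨y, h, a1, a2, b1, b2, hg, y6, fun u v => ?_⟩
  by_cases up : u = p
  · subst up
    by_cases vq : v = q
    · subst vq; rw [epq]; simp [kiteMatrix, cliqueInd, h1, Ne.symm a1, Ne.symm b1, Ne.symm h2]
    · rw [Φ.eisenstein_of_not_adj (by rwa [hp])]
      simp [kiteMatrix, cliqueInd, h1, Ne.symm a1, Ne.symm b1, Ne.symm h2, vq]
  by_cases vp : v = p
  · subst vp
    by_cases uq : u = q
    · subst uq; rw [eqp]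
      simp [kiteMatrix, cliqueInd, Ne.symm h1, Ne.symm a1, Ne.symm b1, Ne.symm h2, Ne.symm a2,
        Ne.symm b2, h1]
    · rw [Φ.eisenstein_of_not_adj (by rwa [hp'])]
      simp [kiteMatrix, cliqueInd, h1, Ne.symm a1, Ne.symm b1, Ne.symm h2, uq, up]
  by_cases uq : u = q
  · subst uq
    by_cases vz : v = z
    · subst vz; rw [eqz]
      simp [kiteMatrix, cliqueInd, Ne.symm h1, Ne.symm a2, Ne.symm b2, Ne.symm h3, h2]
    · rw [Φ.eisenstein_of_not_adj (by rw [hq]; tauto)]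
      simp [kiteMatrix, cliqueInd, Ne.symm h1, Ne.symm a2, Ne.symm b2, Ne.symm h3, vp, vz]
  by_cases vq : v = q
  · subst vq
    by_cases uz : u = z
    · subst uz; rw [ezq]
      simp [kiteMatrix, cliqueInd, Ne.symm h1, Ne.symm a2, Ne.symm b2, h3, h2]
    · rw [Φ.eisenstein_of_not_adj (by rw [hq']; tauto)]
      simp [kiteMatrix, cliqueInd, Ne.symm h1, Ne.symm a2, Ne.symm b2, Ne.symm h3, up, uz, uq]
  by_cases uv : u = v
  · subst uv
    rw [Φ.eisenstein_self]
    rcases hg with rfl | ⟨hab, -⟩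
    · simp [kiteMatrix, cliqueInd, up, uq]
    · have c1 : ¬ (u = a.1 ∧ u = b.1) := fun h => hab (h.1.symm.trans h.2)
      by_cases ua : u = a.1
      · have ub : u ≠ b.1 := fun h => c1 ⟨ua, h⟩
        simp [kiteMatrix, cliqueInd, up, uq, ub]
      · simp [kiteMatrix, cliqueInd, up, uq, ua]
  · have := hE ⟨u, up, uq⟩ ⟨v, vp, vq⟩ (fun h => uv (congrArg Subtype.val h))
    simp only at this
    rw [this, ← yc ⟨u, up, uq⟩, ← yc ⟨v, vp, vq⟩]
    congr 2
    simp only [Subtype.ext_iff]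
    rcases hg with rfl | ⟨hab, -⟩
    · simp [kiteMatrix, cliqueInd, up, uq, vp, vq, uv]
    · by_cases c1 : u = a.1 ∧ v = b.1
      · obtain ⟨rfl, rfl⟩ := c1
        simp [kiteMatrix, cliqueInd, up, uq, vp, vq, uv]
      · by_cases c2 : u = b.1 ∧ v = a.1
        · obtain ⟨rfl, rfl⟩ := c2
          simp [kiteMatrix, cliqueInd, up, uq, vp, vq, uv]
        · rw [if_neg c1, if_neg c2]
          rw [and_comm] at c1 c2
          simp [kiteMatrix, cliqueInd, up, uq, vp, vq, uv, ← ite_and, c1, c2]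

lemma IsKite.card_clique {G : SimpleGraph V} {p q z : V} (h : IsKite G p q z) {m : ℕ}
    (hV : Fintype.card V = m + 2) : Fintype.card {u // u ≠ p ∧ u ≠ q} = m := by
  rw [Fintype.card_subtype]
  have : (Finset.univ.filter fun u => u ≠ p ∧ u ≠ q) = ({p, q} : Finset V)ᶜ := by
    ext u; simp
  rw [this, Finset.card_compl, Finset.card_pair h.p_ne_q, hV]
  rfl

lemma IsKite.isKiteForm_of_balanced {Φ : SignedDigraph V} {p q z : V}
    (h : IsKite Φ.graph p q z) {m : ℕ} (hV : Fintype.card V = m + 2)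
    (hT : (Φ.eisenstein ^ 3).trace = m * (m - 1) * (m - 2)) :
    ∃ x, IsKiteForm Φ p q z z z 1 x := by
  have hK : IsCliqueGain (Matrix.of fun u v : {u // u ≠ p ∧ u ≠ q} => Φ.eisenstein u v) :=
    Φ.isCliqueGain_restrict _ fun u v hu hv => h.clique u v hu.1 hu.2 hv.1 hv.2
  rw [Φ.trace_pow_three_eq_restrict _ (fun u v w => h.not_triangle)] at hT
  obtain ⟨x, hx, hxE⟩ := hK.balanced_of_trace ⟨z, h.z_ne_p, h.z_ne_q⟩
    (by rw [hT, h.card_clique hV])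
  refine h.exists_isKiteForm ⟨z, h.z_ne_p, h.z_ne_q⟩ ⟨z, h.z_ne_p, h.z_ne_q⟩ (Or.inl rfl) x hx
    fun u v huv => ?_
  rw [show Φ.eisenstein u v = _ from hxE u v huv]
  simp

lemma IsKite.isKiteForm_of_oriented {Φ : SignedDigraph V} {p q z : V}
    (h : IsKite Φ.graph p q z) {m : ℕ} (hm : 3 ≤ m) (hV : Fintype.card V = m + 2)
    (hT : (Φ.eisenstein ^ 3).trace = m * (m - 1) * (m - 2) - 3 * (m - 2)) :
    ∃ a b g x, IsKiteForm Φ p q z a b g x ∧ a ≠ b ∧ g + g⁻¹ = 1 ∧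
      (a = z ∨ ∃ r, [p, q, z, a, b, r].Nodup) := by
  have hK : IsCliqueGain (Matrix.of fun u v : {u // u ≠ p ∧ u ≠ q} => Φ.eisenstein u v) :=
    Φ.isCliqueGain_restrict _ fun u v hu hv => h.clique u v hu.1 hu.2 hv.1 hv.2
  rw [Φ.trace_pow_three_eq_restrict _ (fun u v w => h.not_triangle)] at hT
  obtain ⟨a, b, g, x, hab, hg, hz, hx, hxE⟩ := hK.oriented_of_trace ⟨z, h.z_ne_p, h.z_ne_q⟩
    (by rw [h.card_clique hV]; exact hm) (by rw [hT, h.card_clique hV])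
  have hab' : a.1 ≠ b.1 := fun h => hab (Subtype.ext h)
  obtain ⟨y, hy⟩ := h.exists_isKiteForm a b (Or.inr ⟨hab', hg⟩) x hx fun u v huv => hxE u v huv
  refine ⟨a, b, g, y, hy, hab', hg, ?_⟩
  rcases hz with rfl | ⟨r, hr⟩
  · exact Or.inl rfl
  · refine Or.inr ⟨r, ?_⟩
    have hr' := hr.map Subtype.val_injective
    simp only [List.map_cons, List.map_nil] at hr'
    refine List.nodup_cons.2 ⟨?_, List.nodup_cons.2 ⟨?_, hr'⟩⟩
    · simp only [List.mem_cons, List.not_mem_nil, or_false, not_or]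
      exact ⟨h.p_ne_q, h.z_ne_p.symm, a.2.1.symm, b.2.1.symm, r.2.1.symm⟩
    · simp only [List.mem_cons, List.not_mem_nil, or_false, not_or]
      exact ⟨h.z_ne_q.symm, a.2.2.symm, b.2.2.symm, r.2.2.symm⟩

lemma IsKiteForm.unitarilyEquiv {Φ : SignedDigraph V} {p q z a b : V} {g : ℂ} {x : V → ℂ}
    (h : IsKiteForm Φ p q z a b g x) :
    UnitarilyEquiv (kiteMatrix p q z a b g) Φ.eisenstein := by
  refine UnitarilyEquiv.of_diagonal x (fun v => ?_) fun u v => ?_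
  · have : x v ≠ 0 := by
      intro h0
      have := h.pow_six v
      simp [h0] at this
    rw [star_eq_inv_of_pow_six (h.pow_six v), inv_mul_cancel₀ this]
  · rw [h.eq u v, star_eq_inv_of_pow_six (h.pow_six v)]

/-- The vectors supported on three given vertices. -/
noncomputable def supportedOn (u v w : W) : (Fin 3 → ℂ) →ₗ[ℂ] (W → ℂ) where
  toFun c t := (if t = u then c 0 else 0) + (if t = v then c 1 else 0)
    + (if t = w then c 2 else 0)
  map_add' c d := by
    ext t
    simp only [Pi.add_apply]
    split_ifs <;> ring
  map_smul' s c := by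
    ext t
    simp only [Pi.smul_apply, smul_eq_mul, RingHom.id_apply]
    split_ifs <;> ring

open scoped ComplexOrder in
-- Three independent vertices of `Ψ` would give a 3-dimensional space on which its form vanishes;
-- the two conditions of `kiteMatrix_form_neg` select a nonzero vector there whose transform has a
-- negative value.
lemma IsKiteForm.no_three_independent {Φ : SignedDigraph V} {Ψ : SignedDigraph W}
    {p q z a b : V} {g : ℂ} {x : V → ℂ} (h : IsKiteForm Φ p q z a b g x)
    (hΨ : UnitarilyEquiv Φ.eisenstein Ψ.eisenstein) {u v w : W} (huv : u ≠ v) (hvw : v ≠ w)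
    (huw : u ≠ w) (h1 : ¬ Ψ.graph.Adj u v) (h2 : ¬ Ψ.graph.Adj v w) :
    Ψ.graph.Adj u w := by
  by_contra h3
  let l : (V → ℂ) →ₗ[ℂ] (Fin 2 → ℂ) := LinearMap.pi
    (![(LinearMap.proj p : (V → ℂ) →ₗ[ℂ] ℂ) + LinearMap.proj q + LinearMap.proj z,
      cliqueSum p q] :
      Fin 2 → ((V → ℂ) →ₗ[ℂ] ℂ))
  obtain ⟨c, hc, y, hy, hf, hn⟩ := (h.unitarilyEquiv.trans hΨ).exists_ne_zero l
    (supportedOn u v w)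
  have hl1 : y p + y q + y z = 0 := congrFun hy 0
  have hl2 : cliqueSum p q y = 0 := congrFun hy 1
  have hy0 : y ≠ 0 := by
    rintro rfl
    rw [dotProduct_zero, eq_comm, dotProduct_star_self_eq_zero] at hn
    apply hc
    ext i
    fin_cases i
    · simpa [supportedOn, huv, huw] using congrFun hn u
    · simpa [supportedOn, huv.symm, hvw] using congrFun hn v
    · simpa [supportedOn, huw.symm, hvw.symm] using congrFun hn w
  have hneg := kiteMatrix_form_neg h.isKite.z_ne_p h.isKite.z_ne_q h.a_ne_p h.a_ne_q h.b_ne_p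
    h.b_ne_q h.edgeGain hy0 hl1 hl2
  rw [hf] at hneg
  have e := fun s t h => Ψ.eisenstein_of_not_adj (u := s) (v := t) h
  have h1' : ¬ Ψ.graph.Adj v u := fun h => h1 h.symm
  have h2' : ¬ Ψ.graph.Adj w v := fun h => h2 h.symm
  have h3' : ¬ Ψ.graph.Adj w u := fun h => h3 h.symm
  have hzero : star (supportedOn u v w c) ⬝ᵥ (Ψ.eisenstein *ᵥ supportedOn u v w c) = 0 := by
    have hm : ∀ t, (Ψ.eisenstein *ᵥ supportedOn u v w c) t =
        Ψ.eisenstein t u * c 0 + Ψ.eisenstein t v * c 1 + Ψ.eisenstein t w * c 2 := by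
      intro t
      simp only [Matrix.mulVec, dotProduct, supportedOn, LinearMap.coe_mk, AddHom.coe_mk, mul_add,
        Finset.sum_add_distrib, mul_ite, mul_zero, Finset.sum_ite_eq', Finset.mem_univ, if_true]
    refine Finset.sum_eq_zero fun t _ => ?_
    rw [hm]
    by_cases hu : t = u
    · subst hu; rw [Ψ.eisenstein_self, e _ _ h1, e _ _ h3]; ring
    by_cases hv : t = v
    · subst hv; rw [Ψ.eisenstein_self, e _ _ h1', e _ _ h2]; ring
    by_cases hw : t = w
    · subst hw; rw [Ψ.eisenstein_self, e _ _ h2', e _ _ h3']; ring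
    · simp [supportedOn, hu, hv, hw]
  rw [hzero] at hneg
  simp at hneg

omit [Fintype V] [Fintype W] in
lemma kiteMatrix_equiv (e : V ≃ W) (p q z a b : V) (g : ℂ) (u v : V) :
    kiteMatrix (e p) (e q) (e z) (e a) (e b) g (e u) (e v) = kiteMatrix p q z a b g u v := by
  simp only [kiteMatrix, cliqueInd, e.injective.eq_iff]

omit [Fintype V] in
lemma kiteMatrix_transpose (p q z a b : V) (g : ℂ) (u v : V) :
    kiteMatrix p q z a b g v u = kiteMatrix p q z a b g⁻¹ u v := by
  have : (if v = u then cliqueInd p q v else 0) = if u = v then cliqueInd p q u else 0 := by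
    by_cases h : u = v
    · subst h; rfl
    · rw [if_neg h, if_neg (Ne.symm h)]
  simp only [kiteMatrix, inv_inv, this]
  ring

omit [DecidableEq V] [DecidableEq W] in
lemma exists_equiv_map_tuple (hcard : Fintype.card V = Fintype.card W) {k : ℕ} {t : Fin k → V}
    {t' : Fin k → W} (ht : Function.Injective t) (ht' : Function.Injective t') :
    ∃ e : V ≃ W, ∀ i, e (t i) = t' i := by
  classical
  let f : V → W := Function.extend t t' (Fintype.equivOfCardEq hcard)
  have hf : ∀ i, f (t i) = t' i := fun i => ht.extend_apply _ _ i
  obtain ⟨e, he⟩ := Finset.exists_equiv_extend_of_card_eq (t := (Finset.univ : Finset W))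
    (s := Finset.univ.image t) (f := f) hcard (Finset.subset_univ _) (by
      intro x hx y hy hxy
      simp only [Finset.coe_image, Finset.coe_univ, Set.image_univ, Set.mem_range] at hx hy
      obtain ⟨i, rfl⟩ := hx
      obtain ⟨j, rfl⟩ := hy
      rw [hf, hf] at hxy
      rw [ht' hxy])
  refine ⟨e.trans (Equiv.subtypeUnivEquiv Finset.mem_univ), fun i => ?_⟩
  exact (he (t i) (by simp)).trans (hf i)

omit [Fintype V] [DecidableEq V] [Fintype W] [DecidableEq W] in
/-- Eisenstein matrices with the same normal form are switching isomorphic. -/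
lemma switchingRelabelling_of_eq {Φ : SignedDigraph V} {Ψ : SignedDigraph W} (e : V ≃ W)
    {x y : V → ℂ} (hx : ∀ u, x u ^ 6 = 1) (hy : ∀ u, y u ^ 6 = 1) {M : Matrix V V ℂ}
    (h : ∀ u v, Φ.eisenstein u v = x u * M u v * (x v)⁻¹)
    (h' : ∀ u v, Ψ.eisenstein (e u) (e v) = y u * M u v * (y v)⁻¹) :
    SwitchingRelabelling Φ Ψ := by
  have hw : ∀ u, (y u * (x u)⁻¹) ^ 6 = 1 := fun u => by rw [mul_pow, inv_pow, hx, hy]; simp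
  refine ⟨e, fun u => rootsOfUnity.mkOfPowEq _ (hw u), fun u v => ?_⟩
  have x0 : ∀ u, x u ≠ 0 := by
    intro u h0
    have := hx u
    simp [h0] at this
  have y0 : ∀ u, y u ≠ 0 := by
    intro u h0
    have := hy u
    simp [h0] at this
  rw [h, h', rootsOfUnity.coe_mkOfPowEq, rootsOfUnity.coe_mkOfPowEq]
  have := x0 u
  have := x0 v
  have := y0 v
  field_simp

omit [Fintype V] [Fintype W] in
-- Inverting `g` transposes the kite matrix, so the second alternative is absorbed by the converse.
lemma IsKiteForm.switchingIsomorphic {Φ : SignedDigraph V} {Ψ : SignedDigraph W}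
    {p q z a b : V} {g g' : ℂ} {x : V → ℂ} {y : W → ℂ} (h : IsKiteForm Φ p q z a b g x)
    (e : V ≃ W) (h' : IsKiteForm Ψ (e p) (e q) (e z) (e a) (e b) g' y)
    (hg : g' = g ∨ g' = g⁻¹) : SwitchingIsomorphic Φ Ψ := by
  rcases hg with rfl | rfl
  · refine Or.inl (switchingRelabelling_of_eq e h.pow_six (fun u => h'.pow_six (e u)) h.eq
      fun u v => ?_)
    rw [h'.eq, kiteMatrix_equiv]
  · refine Or.inr (switchingRelabelling_of_eq e (y := fun u => (y (e u))⁻¹) h.pow_six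
      (fun u => ?_) h.eq fun u v => ?_)
    · rw [inv_pow, h'.pow_six, inv_one]
    · rw [eisenstein_converse, h'.eq, kiteMatrix_equiv, kiteMatrix_transpose, inv_inv, inv_inv]
      ring

/-- On six vertices the oriented kite gives 96 wherever its edge lies, while the linked triangles
allow at most 84. The cube cannot separate them, since both values are 18. -/
lemma trace_kiteMatrix_pow_four {g : ℂ} (hg : g + g⁻¹ = 1) :
    (kiteMatrix (0 : Fin 6) 1 2 2 3 g ^ 4).trace = 96 := by
  have h0 : g ≠ 0 := by rintro rfl; simp at hg
  have h1 : g ^ 2 = g - 1 := by field_simp at hg; linear_combination hg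
  have h2 : g⁻¹ = 1 - g := by linear_combination hg
  have h3 : g ^ 3 = -1 := by linear_combination (g + 1) * h1
  have h4 : g ^ 4 = -g := by linear_combination g * h3
  have hM : kiteMatrix (0 : Fin 6) 1 2 2 3 g =
      !![0, 1, 0, 0, 0, 0;
         1, 0, 1, 0, 0, 0;
         0, 1, 0, g, 1, 1;
         0, 0, 1 - g, 0, 1, 1;
         0, 0, 1, 1, 0, 1;
         0, 0, 1, 1, 1, 0] := by
    ext i j
    fin_cases i <;> fin_cases j <;> simp [kiteMatrix, cliqueInd, h2]
    ring
  rw [hM, show ∀ M : Matrix (Fin 6) (Fin 6) ℂ, M ^ 4 = M * M * (M * M) from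
    fun M => by noncomm_ring]
  simp only [Matrix.trace, Matrix.diag_apply, Matrix.mul_apply, Fin.sum_univ_six]
  simp
  ring_nf
  simp only [h1, h3, h4]
  ring

lemma trace_kiteMatrix_pow_four' {g : ℂ} (hg : g + g⁻¹ = 1) :
    (kiteMatrix (0 : Fin 6) 1 2 3 4 g ^ 4).trace = 96 := by
  have h0 : g ≠ 0 := by rintro rfl; simp at hg
  have h1 : g ^ 2 = g - 1 := by field_simp at hg; linear_combination hg
  have h2 : g⁻¹ = 1 - g := by linear_combination hg
  have h3 : g ^ 3 = -1 := by linear_combination (g + 1) * h1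
  have h4 : g ^ 4 = -g := by linear_combination g * h3
  have hM : kiteMatrix (0 : Fin 6) 1 2 3 4 g =
      !![0, 1, 0, 0, 0, 0;
         1, 0, 1, 0, 0, 0;
         0, 1, 0, 1, 1, 1;
         0, 0, 1, 0, g, 1;
         0, 0, 1, 1 - g, 0, 1;
         0, 0, 1, 1, 1, 0] := by
    ext i j
    fin_cases i <;> fin_cases j <;> simp [kiteMatrix, cliqueInd, h2]
    ring
  rw [hM, show ∀ M : Matrix (Fin 6) (Fin 6) ℂ, M ^ 4 = M * M * (M * M) from
    fun M => by noncomm_ring]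
  simp only [Matrix.trace, Matrix.diag_apply, Matrix.mul_apply, Fin.sum_univ_six]
  simp
  ring_nf
  simp only [h1, h3, h4]
  ring

lemma trace_linkedTriangles_pow_three :
    ((Matrix.of linkedTriangles : Matrix (Fin 6) (Fin 6) ℕ) ^ 3).trace = 18 := by
  decide

lemma trace_linkedTriangles_pow_four :
    ((Matrix.of linkedTriangles : Matrix (Fin 6) (Fin 6) ℕ) ^ 4).trace = 84 := by
  decide

end NormalForm

/-! ### Trace invariants, exclusion of the exceptions, and conclusion. -/

variable {V W : Type*} [Fintype V] [DecidableEq V] [Fintype W] [DecidableEq W]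

lemma SwitchingRelabelling.trace_pow_three {Φ : SignedDigraph V}
    {Ψ : SignedDigraph W} (h : SwitchingRelabelling Φ Ψ) :
    (Φ.eisenstein ^ 3).trace = (Ψ.eisenstein ^ 3).trace := by
  obtain ⟨e, x, h⟩ := h
  rw [SignedDigraph.trace_pow_three, SignedDigraph.trace_pow_three, ← e.sum_comp]
  refine Finset.sum_congr rfl fun u _ => ?_
  rw [← e.sum_comp]
  refine Finset.sum_congr rfl fun v _ => ?_
  rw [← e.sum_comp]
  refine Finset.sum_congr rfl fun w _ => ?_
  rw [h, h, h]
  have := (x u : ℂˣ).ne_zero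
  have := (x v : ℂˣ).ne_zero
  have := (x w : ℂˣ).ne_zero
  field_simp

lemma trace_converse_pow_three (Φ : SignedDigraph V) :
    (Φ.converse.eisenstein ^ 3).trace = (Φ.eisenstein ^ 3).trace := by
  have : Φ.converse.eisenstein = Φ.eisensteinᵀ := by
    ext u v
    rw [eisenstein_converse, Matrix.transpose_apply]
  rw [this, ← Matrix.transpose_pow, Matrix.trace_transpose]

lemma SwitchingIsomorphic.trace_pow_three {Φ : SignedDigraph V}
    {Ψ : SignedDigraph W} (h : SwitchingIsomorphic Φ Ψ) :
    (Φ.eisenstein ^ 3).trace = (Ψ.eisenstein ^ 3).trace := by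
  rcases h with h | h
  · exact h.trace_pow_three
  · rw [h.trace_pow_three, trace_converse_pow_three]

lemma trace_complete_pow_three (m : ℕ) :
    ((complete m).eisenstein ^ 3).trace = m * (m - 1) * (m - 2) := by
  have : (complete m).eisenstein = Matrix.of (fun _ _ => (1 : ℂ)) - 1 + 0 := by
    ext i j
    by_cases h : i = j
    · subst h; simp [eisenstein_self]
    · simp [eisenstein, complete, h]
  rw [this, trace_complete_add_pow_three]
  simp

lemma omega_add_inv : ((omega : ℂˣ) : ℂ) + ((omega : ℂˣ) : ℂ)⁻¹ = 1 := by
  have h : ((omega : ℂˣ) : ℂ) = Complex.exp ((Real.pi / 3 : ℝ) * Complex.I) := by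
    simp only [omega, Units.val_mk0]
    congr 1
    push_cast
    ring
  rw [h, ← Complex.exp_neg, ← neg_mul, ← Complex.two_cos, ← Complex.ofReal_cos,
    Real.cos_pi_div_three]
  norm_num

/-- For `m ≤ 2` no triangle sees the oriented edge and the trace is the balanced one; the second
case is kept to `m ≥ 3`, where the trace can detect the gain. -/
lemma trace_orientedComplete_pow_three (m : ℕ) :
    ((orientedComplete m).eisenstein ^ 3).trace = m * (m - 1) * (m - 2) ∨
      3 ≤ m ∧ ((orientedComplete m).eisenstein ^ 3).trace =
        m * (m - 1) * (m - 2) - 3 * (m - 2) := by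
  by_cases hm : 2 ≤ m
  · obtain ⟨k, rfl⟩ := Nat.exists_eq_add_of_le' hm
    have h : (orientedComplete (k + 2)).eisenstein =
        cliqueMatrix (0 : Fin (k + 2)) 1 ((omega : ℂˣ) : ℂ) := by
      ext i j
      by_cases hij : i = j
      · subst hij; simp [eisenstein_self, cliqueMatrix]
      · simp only [eisenstein, orientedComplete, cliqueMatrix, Matrix.of_apply, if_false,
          SimpleGraph.top_adj, ne_eq, hij, not_false_eq_true, dif_pos]
        have e1 : (i.val = 0 ∧ j.val = 1) ↔ (i = 0 ∧ j = 1) := by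
          rw [Fin.ext_iff, Fin.ext_iff, Fin.val_zero, Fin.val_one]
        have e2 : (i.val = 1 ∧ j.val = 0) ↔ (i = 1 ∧ j = 0) := by
          rw [Fin.ext_iff, Fin.ext_iff, Fin.val_zero, Fin.val_one]
        simp only [e1, e2]
        split_ifs <;> simp
    have hT : ((orientedComplete (k + 2)).eisenstein ^ 3).trace =
        (k + 2 : ℕ) * ((k + 2 : ℕ) - 1) * ((k + 2 : ℕ) - 2) - 3 * ((k + 2 : ℕ) - 2) := by
      rw [h, trace_cliqueMatrix_pow_three (by simp), omega_add_inv, Fintype.card_fin]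
      ring
    rcases Nat.eq_zero_or_pos k with rfl | hk
    · left; rw [hT]; norm_num
    · exact Or.inr ⟨by omega, hT⟩
  · left
    have : Subsingleton (Fin m) := Fin.subsingleton_iff_le_one.2 (by omega)
    have h0 : (orientedComplete m).eisenstein = 0 := by
      ext i j
      rw [Subsingleton.elim i j, eisenstein_self]; rfl
    rw [h0]
    have : m = 0 ∨ m = 1 := by omega
    rcases this with rfl | rfl <;> simp

/-- A signed digraph consisting of a triangle and an isolated vertex. -/
lemma trace_ne_zero_of_triangle {Ψ : SignedDigraph W} (hW : Fintype.card W = 4) (v : W)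
    (hv : ∀ w, ¬ Ψ.graph.Adj v w)
    (h : ∀ u w, u ≠ v → w ≠ v → u ≠ w → Ψ.graph.Adj u w) : (Ψ.eisenstein ^ 3).trace ≠ 0 := by
  rw [Ψ.trace_pow_three_eq_restrict (fun x => x ≠ v) (fun u w _ hu h1 _ => by
    rw [not_not] at hu; subst hu; exact absurd h1 (hv w))]
  have hK : IsCliqueGain (Matrix.of fun u w : {x // x ≠ v} => Ψ.eisenstein u w) :=
    Ψ.isCliqueGain_restrict _ h
  set K := Matrix.of fun u w : {x // x ≠ v} => Ψ.eisenstein u w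
  have hc : Fintype.card {x // x ≠ v} = 3 := by
    rw [Fintype.card_subtype_compl, Fintype.card_subtype_eq, hW]
  let e := (Fintype.equivFinOfCardEq hc).symm
  rw [trace_pow_three, ← e.sum_comp]
  have e1 : ∀ i, ∑ j, ∑ k, K (e i) j * K j k * K k (e i) =
      ∑ j, ∑ k, K (e i) (e j) * K (e j) (e k) * K (e k) (e i) := by
    intro i
    rw [← e.sum_comp]
    exact Finset.sum_congr rfl fun j _ => (e.sum_comp _).symm
  have n01 : e 0 ≠ e 1 := e.injective.ne (by decide)
  have n02 : e 0 ≠ e 2 := e.injective.ne (by decide)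
  have n12 : e 1 ≠ e 2 := e.injective.ne (by decide)
  simp only [e1, Fin.sum_univ_three, hK.diag, hK.inv _ _ n01, hK.inv _ _ n02, hK.inv _ _ n12,
    mul_zero, zero_mul, add_zero, zero_add]
  have p1 := hK.pow_six _ _ n01
  have p2 := hK.pow_six _ _ n02
  have p3 := hK.pow_six _ _ n12
  have z1 := hK.ne_zero n01
  have z2 := hK.ne_zero n02
  have z3 := hK.ne_zero n12
  generalize K (e 0) (e 1) = a at *
  generalize K (e 0) (e 2) = b at *
  generalize K (e 1) (e 2) = c at *
  -- The trace is `3 * (t + t⁻¹)` with `t = a * c / b`; if it vanished, then `t² = -1` and `t⁶ =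
  -- -1`, although `t⁶ = 1`.
  intro h0
  have h1 : (a * c) ^ 2 = - b ^ 2 := by
    field_simp at h0
    linear_combination h0 / 3
  have h2 : (a * c) ^ 6 = - b ^ 6 := by
    calc (a * c) ^ 6 = ((a * c) ^ 2) ^ 3 := by ring
      _ = - b ^ 6 := by rw [h1]; ring
  rw [mul_pow, p1, p2, p3] at h2
  norm_num at h2

lemma trace_adjMatrix_pow_linkedTriangles {G : SimpleGraph W} [DecidableRel G.Adj] (e : Fin 6 ≃ W)
    (he : ∀ i j, G.Adj (e i) (e j) ↔ linkedTriangles i j = 1) (k : ℕ) :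
    (G.adjMatrix ℝ ^ k).trace =
      ((Matrix.of linkedTriangles : Matrix (Fin 6) (Fin 6) ℕ) ^ k).trace := by
  have h01 : ∀ i j, linkedTriangles i j = 0 ∨ linkedTriangles i j = 1 := by decide
  have h : (Nat.castRingHom ℝ).mapMatrix (Matrix.of linkedTriangles) =
      Matrix.reindexAlgEquiv ℝ ℝ e.symm (G.adjMatrix ℝ) := by
    ext i j
    simp only [RingHom.mapMatrix_apply, Matrix.map_apply, Matrix.of_apply,
      Matrix.coe_reindexAlgEquiv, Matrix.reindex_apply, Equiv.symm_symm, Matrix.submatrix_apply,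
      SimpleGraph.adjMatrix_apply, he]
    rcases h01 i j with h | h <;> simp [h]
  have h2 := congrArg (fun M => (M ^ k).trace) h
  simp only [← map_pow] at h2
  rw [Matrix.coe_reindexAlgEquiv, Matrix.reindex_apply] at h2
  have h3 : (((G.adjMatrix ℝ) ^ k).submatrix e.symm.symm e.symm.symm).trace =
      ((G.adjMatrix ℝ) ^ k).trace := by
    simp only [Matrix.trace, Matrix.diag_apply, Matrix.submatrix_apply, Equiv.symm_symm]
    exact e.sum_comp (fun i => ((G.adjMatrix ℝ) ^ k) i i)
  rw [h3] at h2
  rw [← h2]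
  simp [Matrix.trace]

lemma trace_kiteMatrix_pow_four_of_card (hV : Fintype.card V = 6) {p q z a b : V} {g : ℂ}
    (hg : g + g⁻¹ = 1) (hpq : p ≠ q) (hzp : z ≠ p) (hzq : z ≠ q) (hbp : b ≠ p) (hbq : b ≠ q)
    (hab : a ≠ b) (h : a = z ∨ ∃ r, [p, q, z, a, b, r].Nodup) :
    (kiteMatrix p q z a b g ^ 4).trace = 96 := by
  have key : ∀ (e : Fin 6 ≃ V) (i₀ i₁ i₂ i₃ i₄ : Fin 6),
      (kiteMatrix (e i₀) (e i₁) (e i₂) (e i₃) (e i₄) g ^ 4).trace =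
        (kiteMatrix i₀ i₁ i₂ i₃ i₄ g ^ 4).trace := by
    intro e i₀ i₁ i₂ i₃ i₄
    have : kiteMatrix i₀ i₁ i₂ i₃ i₄ g = Matrix.reindexAlgEquiv ℂ ℂ e.symm
        (kiteMatrix (e i₀) (e i₁) (e i₂) (e i₃) (e i₄) g) := by
      ext i j
      simp [kiteMatrix_equiv]
    rw [this, ← map_pow, Matrix.coe_reindexAlgEquiv, Matrix.reindex_apply]
    simp only [Matrix.trace, Matrix.diag_apply, Matrix.submatrix_apply, Equiv.symm_symm]
    exact (e.sum_comp (fun i => ((kiteMatrix (e i₀) (e i₁) (e i₂) (e i₃) (e i₄) g) ^ 4) i i)).symm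
  rcases h with rfl | ⟨r, hr⟩
  · have hinj : Function.Injective ![p, q, a, b] := by
      rw [← List.nodup_ofFn]
      simp [hpq, hzp.symm, hzq.symm, hbp.symm, hbq.symm, hab]
    obtain ⟨e, he⟩ := exists_equiv_map_tuple (V := Fin 6) (by simp [hV])
      (t := ![0, 1, 2, 3]) (by decide) hinj
    have e0 : e 0 = p := he 0
    have e1 : e 1 = q := he 1
    have e2 : e 2 = a := he 2
    have e3 : e 3 = b := he 3
    have := key e 0 1 2 2 3
    rwa [e0, e1, e2, e3, trace_kiteMatrix_pow_four hg] at this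
  · have hinj : Function.Injective ![p, q, z, a, b, r] := by
      rw [← List.nodup_ofFn]
      simpa using hr
    obtain ⟨e, he⟩ := exists_equiv_map_tuple (V := Fin 6) (by simp [hV])
      (t := ![0, 1, 2, 3, 4, 5]) (by decide) hinj
    have e0 : e 0 = p := he 0
    have e1 : e 1 = q := he 1
    have e2 : e 2 = z := he 2
    have e3 : e 3 = a := he 3
    have e4 : e 4 = b := he 4
    have := key e 0 1 2 3 4
    rwa [e0, e1, e2, e3, e4, trace_kiteMatrix_pow_four' hg] at this

/-- The Eisenstein matrix of an oriented kite determines whether the oriented edge meets the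
attachment vertex, hence the kite up to switching isomorphism. -/
lemma switchingIsomorphic_of_oriented {Φ : SignedDigraph V} {Ψ : SignedDigraph W}
    (hcard : Fintype.card V = Fintype.card W)
    (hU : UnitarilyEquiv Φ.eisenstein Ψ.eisenstein) {p q z a b : V} {p' q' z' a' b' : W}
    {g g' : ℂ} {x : V → ℂ} {x' : W → ℂ} (h : IsKiteForm Φ p q z a b g x)
    (h' : IsKiteForm Ψ p' q' z' a' b' g' x') (hab : a ≠ b) (hab' : a' ≠ b') (hg : g + g⁻¹ = 1)
    (hg' : g' + g'⁻¹ = 1) (hz : a = z ∨ ∃ r, [p, q, z, a, b, r].Nodup)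
    (hz' : a' = z' ∨ ∃ r, [p', q', z', a', b', r].Nodup) : SwitchingIsomorphic Φ Ψ := by
  have hUk := (h.unitarilyEquiv.trans hU).trans h'.unitarilyEquiv.symm
  -- Both gains are roots of `X² - X + 1`, whose two roots are mutually inverse.
  have hgg : g' = g ∨ g' = g⁻¹ := by
    have h0 : g ≠ 0 := by rintro rfl; simp at hg
    have h0' : g' ≠ 0 := by rintro rfl; simp at hg'
    have e1 : g⁻¹ = 1 - g := by linear_combination hg
    have e2 : (g' - g) * (g' - (1 - g)) = 0 := by
      field_simp at hg hg'
      linear_combination hg' - hg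
    rw [e1]
    rcases mul_eq_zero.1 e2 with h | h
    · exact Or.inl (sub_eq_zero.1 h)
    · exact Or.inr (sub_eq_zero.1 h)
  have k1 := h.isKite.p_ne_q
  have k1' := h'.isKite.p_ne_q
  rcases hz with rfl | ⟨r, hr⟩
  · rcases hz' with rfl | ⟨r', hr'⟩
    · have hinj : Function.Injective ![p, q, a, b] := by
        rw [← List.nodup_ofFn]
        simp [k1, h.a_ne_p.symm, h.a_ne_q.symm, h.b_ne_p.symm, h.b_ne_q.symm, hab]
      have hinj' : Function.Injective ![p', q', a', b'] := by
        rw [← List.nodup_ofFn]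
        simp [k1', h'.a_ne_p.symm, h'.a_ne_q.symm, h'.b_ne_p.symm, h'.b_ne_q.symm, hab']
      obtain ⟨e, he⟩ := exists_equiv_map_tuple hcard hinj hinj'
      obtain rfl : e p = p' := he 0
      obtain rfl : e q = q' := he 1
      obtain rfl : e a = a' := he 2
      obtain rfl : e b = b' := he 3
      exact h.switchingIsomorphic e h' hgg
    · exact absurd hUk (not_unitarilyEquiv_kiteMatrix k1 hg hg' hr')
  · rcases hz' with rfl | ⟨r', hr'⟩
    · exact absurd hUk.symm (not_unitarilyEquiv_kiteMatrix k1' hg' hg hr)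
    · have hinj : Function.Injective ![p, q, z, a, b, r] := by
        rw [← List.nodup_ofFn]
        simpa using hr
      have hinj' : Function.Injective ![p', q', z', a', b', r'] := by
        rw [← List.nodup_ofFn]
        simpa using hr'
      obtain ⟨e, he⟩ := exists_equiv_map_tuple hcard hinj hinj'
      obtain rfl : e p = p' := he 0
      obtain rfl : e q = q' := he 1
      obtain rfl : e z = z' := he 2
      obtain rfl : e a = a' := he 3
      obtain rfl : e b = b' := he 4
      exact h.switchingIsomorphic e h' hgg

lemma switchingIsomorphic_of_balanced {Φ : SignedDigraph V} {Ψ : SignedDigraph W}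
    (hcard : Fintype.card V = Fintype.card W) {p q z : V} {p' q' z' : W}
    {x : V → ℂ} {x' : W → ℂ} (h : IsKiteForm Φ p q z z z 1 x)
    (h' : IsKiteForm Ψ p' q' z' z' z' 1 x') : SwitchingIsomorphic Φ Ψ := by
  have hinj : Function.Injective ![p, q, z] := by
    rw [← List.nodup_ofFn]
    simp [h.isKite.p_ne_q, h.a_ne_p.symm, h.a_ne_q.symm]
  have hinj' : Function.Injective ![p', q', z'] := by
    rw [← List.nodup_ofFn]
    simp [h'.isKite.p_ne_q, h'.a_ne_p.symm, h'.a_ne_q.symm]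
  obtain ⟨e, he⟩ := exists_equiv_map_tuple hcard hinj hinj'
  obtain rfl : e p = p' := he 0
  obtain rfl : e q = q' := he 1
  obtain rfl : e z = z' := he 2
  exact h.switchingIsomorphic e h' (Or.inl rfl)

/-- A signed digraph that is cospectral to a balanced or oriented kite is a kite. -/
lemma exists_isKite_of_unitarilyEquiv {Φ : SignedDigraph V} {Ψ : SignedDigraph W} {m : ℕ}
    (hm : 1 ≤ m) (hV : Fintype.card V = m + 2) (hW : Fintype.card W = m + 2)
    (hU : UnitarilyEquiv Φ.eisenstein Ψ.eisenstein) {p q z a b : V} {g : ℂ} {x : V → ℂ}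
    (h : IsKiteForm Φ p q z a b g x)
    (hT : (Φ.eisenstein ^ 3).trace = m * (m - 1) * (m - 2) ∨
      (3 ≤ m ∧ (Φ.eisenstein ^ 3).trace = m * (m - 1) * (m - 2) - 3 * (m - 2) ∧
        a ≠ b ∧ g + g⁻¹ = 1 ∧ (a = z ∨ ∃ r, [p, q, z, a, b, r].Nodup))) :
    ∃ p' q' z', IsKite Ψ.graph p' q' z' := by
  classical
  have hind : ∀ u v w, Ψ.graphᶜ.Adj u v → Ψ.graphᶜ.Adj v w → ¬ Ψ.graphᶜ.Adj u w := by
    intro u v w h1 h2 h3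
    rw [SimpleGraph.compl_adj] at h1 h2 h3
    exact h3.2 (h.no_three_independent hU h1.1 h2.1 h3.1 h1.2 h2.2)
  have hsum : ∑ u, Ψ.graphᶜ.degree u + 2 = 4 * m := by
    have h1 := (hU.pow 2).trace_eq
    rw [trace_eisenstein_sq, trace_eisenstein_sq, h.isKite.sum_adj hV] at h1
    have h2 : ∀ u, (∑ v, if Ψ.graph.Adj u v then (1 : ℂ) else 0) =
        m + 1 - (Ψ.graphᶜ.degree u : ℂ) := by
      intro u
      have h3 : Ψ.graph.degree u + Ψ.graphᶜ.degree u = m + 1 := by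
        have := Ψ.graph.degree_compl (v := u)
        have h4 := Ψ.graph.degree_lt_card_verts u
        omega
      rw [Finset.sum_boole, ← SimpleGraph.neighborFinset_eq_filter,
        SimpleGraph.card_neighborFinset_eq_degree, eq_sub_iff_add_eq]
      exact_mod_cast h3
    simp only [h2, Finset.sum_sub_distrib, Finset.sum_const, Finset.card_univ, hW] at h1
    have h3 : (∑ u, (Ψ.graphᶜ.degree u : ℂ)) + 2 = 4 * m := by
      rw [nsmul_eq_mul] at h1
      push_cast at h1
      linear_combination h1
    exact_mod_cast h3
  have hT3 := (hU.pow 3).trace_eq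
  -- For `m ≥ 2` the balanced trace is at least the oriented one, so the weaker bound serves both
  -- cases.
  have hge : 2 ≤ m → (m : ℝ) * (m - 1) * (m - 2) - 3 * (m - 2) ≤ (Ψ.eisenstein ^ 3).trace.re := by
    intro hm2
    rw [← hT3]
    have : (2 : ℝ) ≤ m := by exact_mod_cast hm2
    rcases hT with hT | ⟨-, hT, -⟩ <;> rw [hT]
    · simp
      linarith
    · simp
  have hsq : 2 ≤ m → 2 * m ^ 2 + m ≤ ∑ u, Ψ.graphᶜ.degree u ^ 2 := fun hm2 =>
    sum_degree_sq_ge rfl hW hind hsum (hge hm2)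
  rcases isKite_or_exceptional hm hW hind hsum hsq with ⟨p', q', z', hk⟩ | ⟨rfl, v, hv⟩ | ⟨rfl, e, he⟩
  · rw [compl_compl] at hk
    exact ⟨p', q', z', hk⟩
  -- For `m = 2` the complement of the star is a triangle with an isolated vertex, while the trace
  -- to be matched is 0.
  · exfalso
    refine trace_ne_zero_of_triangle hW v (fun w hw => ?_) (fun u w hu hw huw => ?_)
      (hT3.symm.trans ?_)
    · exact (hv w hw.ne.symm).2 hw
    · by_contra hn
      exact hind u v w (hv u hu).symm (hv w hw) ⟨huw, hn⟩
    · rcases hT with hT | ⟨h3, -⟩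
      · rw [hT]; norm_num
      · omega
  · exfalso
    rw [compl_compl] at he
    -- The balanced trace of the cube is 24, above the 18 of the linked triangles; the oriented one
    -- ties at 18, and the fourth power decides.
    rcases hT with hT | ⟨-, -, hab, hg, hz⟩
    · have h1 := Ψ.re_trace_eisenstein_pow_le 3
      rw [← hT3, hT, trace_adjMatrix_pow_linkedTriangles e he, trace_linkedTriangles_pow_three] at h1
      norm_num at h1
    · have h1 := Ψ.re_trace_eisenstein_pow_le 4
      rw [← (hU.pow 4).trace_eq, ← (h.unitarilyEquiv.pow 4).trace_eq,
        trace_kiteMatrix_pow_four_of_card hV hg h.isKite.p_ne_q h.isKite.z_ne_p h.isKite.z_ne_q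
        h.b_ne_p h.b_ne_q hab hz, trace_adjMatrix_pow_linkedTriangles e he,
        trace_linkedTriangles_pow_four] at h1
      norm_num at h1

/-- Balanced and oriented kites are determined by their Eisenstein spectra. -/
theorem isDES_of_isKite {V : Type uV} [Fintype V] [DecidableEq V] {Φ : SignedDigraph V} {m : ℕ}
    (hm : 1 ≤ m) (hV : Fintype.card V = m + 2) {p q z : V} (hk : IsKite Φ.graph p q z)
    (hT : (Φ.eisenstein ^ 3).trace = m * (m - 1) * (m - 2) ∨
      3 ≤ m ∧ (Φ.eisenstein ^ 3).trace = m * (m - 1) * (m - 2) - 3 * (m - 2)) :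
    IsDES.{uV, uW} Φ := by
  intro W _ _ Ψ hcos
  have hU : UnitarilyEquiv Φ.eisenstein Ψ.eisenstein :=
    UnitarilyEquiv.of_roots_eq Φ.eisenstein_isHermitian Ψ.eisenstein_isHermitian hcos
  -- The trace of the zeroth power recovers the number of vertices.
  have hcard : Fintype.card V = Fintype.card W := by
    have := (hU.pow 0).trace_eq
    simp only [pow_zero, Matrix.trace_one] at this
    exact_mod_cast this
  have hW : Fintype.card W = m + 2 := hcard ▸ hV
  have hT3 := (hU.pow 3).trace_eq
  rcases hT with hT | ⟨hm3, hT⟩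
  · obtain ⟨x, hx⟩ := hk.isKiteForm_of_balanced hV hT
    obtain ⟨p', q', z', hk'⟩ := exists_isKite_of_unitarilyEquiv hm hV hW hU hx (Or.inl hT)
    obtain ⟨x', hx'⟩ := hk'.isKiteForm_of_balanced hW (hT3.symm.trans hT)
    exact switchingIsomorphic_of_balanced hcard hx hx'
  · obtain ⟨a, b, g, x, hx, hab, hg, hz⟩ := hk.isKiteForm_of_oriented hm3 hV hT
    obtain ⟨p', q', z', hk'⟩ := exists_isKite_of_unitarilyEquiv hm hV hW hU hx
      (Or.inr ⟨hm3, hT, hab, hg, hz⟩)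
    obtain ⟨a', b', g', x', hx', hab', hg', hz'⟩ :=
      hk'.isKiteForm_of_oriented hm3 hW (hT3.symm.trans hT)
    exact switchingIsomorphic_of_oriented hcard hU hx hx' hab hab' hg hg' hz hz'

theorem isDES_of_kiteGraph {V : Type uV} [Fintype V] [DecidableEq V] {m : ℕ} (hm : 1 ≤ m)
    (Φ : SignedDigraph V) (f : kiteGraph m 2 ≃g Φ.graph)
    (hΦ : SwitchingIsomorphic (Φ.induce (Set.range fun i : Fin m => f (Sum.inl i))) (complete m) ∨
      SwitchingIsomorphic (Φ.induce (Set.range fun i : Fin m => f (Sum.inl i)))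
        (orientedComplete m)) : IsDES.{uV, uW} Φ := by
  classical
  have hk := (isKite_kiteGraph hm).map f
  have hV : Fintype.card V = m + 2 := by
    rw [← Fintype.card_congr f.toEquiv]; simp
  have hrange : ∀ u, ¬ u ∈ (Set.range fun i : Fin m => f (Sum.inl i)) →
      ¬ (u ≠ f (Sum.inr 1) ∧ u ≠ f (Sum.inr 0)) := by
    intro u hu
    obtain ⟨y, rfl⟩ := f.surjective u
    rcases y with i | j
    · exact absurd ⟨i, rfl⟩ hu
    · fin_cases j <;> simp
  have htr : (Φ.eisenstein ^ 3).trace =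
      ((Φ.induce (Set.range fun i : Fin m => f (Sum.inl i))).eisenstein ^ 3).trace := by
    rw [Φ.trace_pow_three_eq_restrict (fun x => x ∈ Set.range fun i : Fin m => f (Sum.inl i))
      (fun u v w hu => hk.not_triangle (hrange u hu))]
    congr 2
  refine isDES_of_isKite hm hV hk ?_
  rcases hΦ with h | h
  · left
    rw [htr, h.trace_pow_three, trace_complete_pow_three]
  · rw [htr, h.trace_pow_three]
    exact trace_orientedComplete_pow_three m

end SignedDigraph

theorem mainTheorem4 {V : Type uV} [Fintype V] [DecidableEq V] (n : ℕ) (hn : 3 ≤ n)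
    (Φ : SignedDigraph V) (f : kiteGraph (n - 2) 2 ≃g Φ.graph)
    (hΦ : SignedDigraph.SwitchingIsomorphic
        (Φ.induce (Set.range fun i : Fin (n - 2) => f (Sum.inl i))) (SignedDigraph.complete (n - 2)) ∨
      SignedDigraph.SwitchingIsomorphic
        (Φ.induce (Set.range fun i : Fin (n - 2) => f (Sum.inl i)))
        (SignedDigraph.orientedComplete (n - 2))) :
    SignedDigraph.IsDES.{uV, uW} Φ :=
  SignedDigraph.isDES_of_kiteGraph (by omega) Φ f hΦ
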